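/- Let $k\ge 2$ be an integer and $d\ge 0$ a real number. Notation. Let $\Delta^k$ be the simplex of probability vectors $x=(x^{(1)},\dots,x^{(k)})$, with coordinates indexed modulo $k$. For a measure $\nu$ on $\Delta^k$ let $(\Pi_l\nu)(dx)=k\,x^{(l)}\nu(dx)$, and let $\Gamma\nu$ be the law of the vector whose $m$-th entry is $$\frac{\prod_{i=1}^{D}\bigl(1-X_i^{(m-c_i+1)}\bigr)}{\sum_{m'=1}^k\prod_{i=1}^{D}\bigl(1-X_i^{(m'-c_i+1)}\bigr)},$$ where $D\sim\mathrm{Pois}(d)$, the $c_i$ are i.i.d. uniform on $\{2,\dots,k\}$, the $X_i$ are i.i.d. with law $\nu$, and $D$, $(c_i)$, $(X_i)$ are independent. Put $\Gamma_s\nu=\frac1k\sum_{l=1}^k\Gamma(\Pi_l\nu)$. Let $\Lambda$ replace a vector $x\in\Delta^k$ by the vector that has the entry $\|x\|_\infty$ at a position $m$ chosen uniformly among the positions of the largest entries of $x$, and the entry $(1-\|x\|_\infty)/(k-1)$ elsewhere. Identify a probability measure $\mu$ on $[\frac1k,1]$ with the law on $\Delta^k$ of the vector that has the entry $Y\sim\mu$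 at an independent uniformly chosen position and $(1-Y)/(k-1)$ elsewhere; the inverse of this correspondence is $X\mapsto\|X\|_\infty$. Thus $\Lambda\circ\Gamma_s$ acts on probability measures on $[\frac1k,1]$. For $\varepsilon>0$, $\nu$ stochastically dominates $\mu$ by $\varepsilon$ if for every $x$ either $\mu([-\infty,x])=1$, or $\nu([-\infty,x])=0$, or $\mu([-\infty,x])-\varepsilon\ge\nu([-\infty,x])$. Hypothesis. There are a probability measure $\mu$ on $[\frac1k,1]$ with $\mu\ne\delta_{1/k}$ and a constant $c>0$ such that $(\Lambda\circ\Gamma_s)\mu$ stochastically dominates $\mu$ by $c/\log k$. Conclusion. Let $T$ be the Galton–Watson tree with offspring distribution $\mathrm{Pois}(d)$ and root $\rho$, let $T_n$ be its first $n$ levels and $L_n$ its set of vertices at level $n$. Let $\sigma$ be the $k$-colouring (broadcast) model on $T$: $\sigma_\rho$ is uniform on $[k]$, and given the colour of its parent each other vertex independently receives a uniformly chosen different colour. Let $\mathsf U$ be an array, indexed by the vertices, of independent $\mathrm{Unif}[0,1]$ random variables that is independent of $(T,\sigma)$. Then there are measurable functions $\mathsf B_\rho=\mathsf B_{\rho,n}$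 of $(T_n,\sigma_{L_n},\mathsf U)$, $n\ge0$, such that $$\liminf_{n\to\infty}\ \mathbb E\,\sup_{l\in[k]}\left|P\bigl(\sigma_\rho=l\mid \mathsf B_\rho(T_n,\sigma_{L_n},\mathsf U)\bigr)-\frac1k\right|>0 .$$ -/

import Mathlib

open MeasureTheory ProbabilityTheory Filter Set
open scoped NNReal ENNReal

noncomputable section

namespace ColouringReconstruction

/-! ### Stochastic dominance -/

/-- `ν` stochastically dominates `μ` by `ε`: for every `x`, either `μ((-∞,x]) = 1`, or
`ν((-∞,x]) = 0`, or `μ((-∞,x]) - ε ≥ ν((-∞,x])`.  (For measures on `ℝ` the points `x = ±∞` of the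
extended line impose no condition.) -/
def StochDomBy (μ ν : Measure ℝ) (ε : ℝ) : Prop :=
  ∀ x : ℝ, μ.real (Iic x) = 1 ∨ ν.real (Iic x) = 0 ∨ ν.real (Iic x) ≤ μ.real (Iic x) - ε

/-! ### The distributional recursion on the simplex

The colours `1, …, k` are the elements `0, …, k - 1` of `Fin k`, on which subtraction is modulo `k`.
Vectors `x : Fin k → ℝ` carry the sup norm `‖x‖ = ‖x‖_∞`. -/

/-- The point of the star-shaped set `Λ^k` whose `m`-th entry is `y` and whose other entries are
`(1 - y) / (k - 1)`. -/
def starPoint (k : ℕ) (y : ℝ) (m : Fin k) : Fin k → ℝ :=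
  fun j => if j = m then y else (1 - y) / ((k : ℝ) - 1)

/-- The symmetric measure on `Λ^k` that corresponds to a measure `μ` on `[1/k, 1]`: the law of
`starPoint Y m` with `Y ∼ μ` and an independent uniform `m`. -/
def toStar (k : ℕ) (μ : Measure ℝ) : Measure (Fin k → ℝ) :=
  (μ.prod (uniformOn (univ : Set (Fin k)))).map fun p => starPoint k p.1 p.2

/-- The tilted measure `(Π_l ν)(dx) = k x^{(l)} ν(dx)`. -/
def tilt (k : ℕ) (l : Fin k) (ν : Measure (Fin k → ℝ)) : Measure (Fin k → ℝ) :=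
  ν.withDensity fun x => ENNReal.ofReal ((k : ℝ) * x l)

/-- The map `Γ`, for `D` children, the `i`-th of which has colour `c i` and belief vector `x i`:
its `m`-th entry is `∏_i (1 - x_i^{(m - c_i + 1)})`, normalised (the shift by one is absorbed by the
numbering of the colours from `0`). -/
def gammaMap (k D : ℕ) (p : Fin D → Fin k × (Fin k → ℝ)) : Fin k → ℝ :=
  fun m => (∏ i, (1 - (p i).2 (m - (p i).1))) / ∑ m' : Fin k, ∏ i, (1 - (p i).2 (m' - (p i).1))

/-- The measure `Γ ν`: the law of the map `Γ` when the number `D` of children has law `ξ` and, given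
`D`, the colours of the children are i.i.d. uniform among the colours other than the first one (so
that the numbers `B_2, …, B_k` of children of each colour are multinomial) and the vectors are
i.i.d. with law `ν`. -/
def gamma (k : ℕ) (ξ : Measure ℕ) (ν : Measure (Fin k → ℝ)) : Measure (Fin k → ℝ) :=
  Measure.sum fun D : ℕ => ξ {D} •
    (Measure.pi fun _ : Fin D => (uniformOn {l : Fin k | (l : ℕ) ≠ 0}).prod ν).map (gammaMap k D)

/-- `Γ_s ν = (1/k) ∑_l Γ (Π_l ν)`. -/
def gammaS (k : ℕ) (ξ : Measure ℕ) (ν : Measure (Fin k → ℝ)) : Measure (Fin k → ℝ) :=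
  (k : ℝ≥0∞)⁻¹ • ∑ l : Fin k, gamma k ξ (tilt k l ν)

open Classical in
/-- The action of `Λ` on measures: the law of `starPoint ‖X‖_∞ m` where `X ∼ ν` and, given `X`, the
index
`m` is uniform on the set of the largest entries of `X`. -/
def lambda (k : ℕ) (ν : Measure (Fin k → ℝ)) : Measure (Fin k → ℝ) :=
  ∑ m : Fin k,
    (ν.withDensity fun x =>
      if x m = ‖x‖ then ((Finset.univ.filter fun j => x j = ‖x‖).card : ℝ≥0∞)⁻¹ else 0).map
    fun x => starPoint k ‖x‖ m

/-- The transformation that `Λ ∘ Γ_s` induces on measures on `[1/k, 1]`, through the correspondence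
between these and the symmetric measures on `Λ^k`, whose inverse is `X ↦ ‖X‖_∞`. -/
def lambdaGammaS (k : ℕ) (ξ : Measure ℕ) (μ : Measure ℝ) : Measure ℝ :=
  (lambda k (gammaS k ξ (toStar k μ))).map fun x => ‖x‖

/-- For the offspring law `Pois(d)` there are a probability measure `μ` on `[1/k, 1]`, other than the
trivial one `δ_{1/k}`, and `c > 0` such that `(Λ ∘ Γ_s) μ` stochastically dominates `μ` by
`c / log k`. -/
def HasDominatedMeasure (k : ℕ) (d : ℝ≥0) : Prop :=
  ∃ μ : Measure ℝ, IsProbabilityMeasure μ ∧ μ (Icc (1 / (k : ℝ)) 1)ᶜ = 0 ∧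
    μ ≠ Measure.dirac (1 / (k : ℝ)) ∧
    ∃ c : ℝ, 0 < c ∧ StochDomBy μ (lambdaGammaS k (poissonMeasure d) μ) (c / Real.log k)

/-! ### The colouring model on the Galton–Watson tree -/

/-- Possible vertices of an ordered tree: `[]` is the root, and `i :: v` is the `i`-th child of `v`
(`i = 0, 1, …`). -/
abbrev Vertex : Type := List ℕ

/-- `v` is a vertex of the tree in which each vertex `u` has `N u` children. -/
def IsVertex (N : Vertex → ℕ) : Vertex → Prop
  | [] => True
  | i :: v => IsVertex N v ∧ i < N v

/-- The channel `M(·, j)` of the colouring model as a measure: `M(i, j) = 1{i ≠ j} / (k - 1)`. -/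
def channel (k : ℕ) (j : Fin k) : Measure (Fin k) :=
  ∑ i : Fin k, ENNReal.ofReal (if i ≠ j then 1 / ((k : ℝ) - 1) else 0) • Measure.dirac i

/-- Sample points: the numbers of children `N`, the colour of the root, for each vertex `v` the
outputs `W v j` of the channel on the edge from the parent of `v` to `v` for each input `j`, and the
array `U`. -/
abbrev Sample (k : ℕ) : Type :=
  (Vertex → ℕ) × Fin k × (Vertex → Fin k → Fin k) × (Vertex → unitInterval)

/-- The law of the sample: all components are independent; `N v ∼ ξ`, the colour of the root is
uniform, `W v j ∼ M(·, j)`, and `U v` is uniform on `[0, 1]`. -/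
def law (k : ℕ) (ξ : Measure ℕ) : Measure (Sample k) :=
  (Measure.infinitePi fun _ : Vertex => ξ).prod
    ((uniformOn (univ : Set (Fin k))).prod
      ((Measure.infinitePi fun _ : Vertex => Measure.pi fun j : Fin k => channel k j).prod
        (Measure.infinitePi fun _ : Vertex => (volume : Measure unitInterval))))

variable {k : ℕ}

/-- The colour `σ_v`: the colour of a child is the output of the channel on its edge, applied to the
colour of its parent. -/
def colour (ω : Sample k) : Vertex → Fin k
  | [] => ω.2.1
  | i :: v => ω.2.2.1 (i :: v) (colour ω v)

/-- `T_n`: the vertices of the first `n` levels of the tree. -/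
def levels (n : ℕ) (ω : Sample k) : Set Vertex := {v | IsVertex ω.1 v ∧ v.length ≤ n}

/-- `L_n`: the vertices at level `n`. -/
def level (n : ℕ) (ω : Sample k) : Set Vertex := {v | IsVertex ω.1 v ∧ v.length = n}

/-- The configuration `σ_{L_n}`, given by its graph `{(v, σ_v) : v ∈ L_n}`. -/
def levelColours (n : ℕ) (ω : Sample k) : Set (Vertex × Fin k) :=
  {q | q.1 ∈ level n ω ∧ q.2 = colour ω q.1}

/-- The array `U` of independent uniform random variables. -/
def uniforms (ω : Sample k) : Vertex → unitInterval := ω.2.2.2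

/-- The triple `(T_n, σ_{L_n}, U)`. -/
def observation (n : ℕ) (ω : Sample k) :
    Set Vertex × Set (Vertex × Fin k) × (Vertex → unitInterval) :=
  (levels n ω, levelColours n ω, uniforms ω)

/-- `E sup_l |P(σ_ρ = l | Y) - 1/k|` for a random variable `Y` on the sample space. -/
def rootBias {β : Type*} [MeasurableSpace β] (P : Measure (Sample k)) (Y : Sample k → β) : ℝ :=
  ∫ ω, ⨆ l : Fin k,
    |(P⟦{ω' : Sample k | colour ω' [] = l} | MeasurableSpace.comap Y inferInstance⟧) ω
      - 1 / (k : ℝ)| ∂P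

end ColouringReconstruction

end

open ColouringReconstruction

open MeasureTheory ProbabilityTheory Filter Set
open scoped NNReal ENNReal

noncomputable section

namespace ColouringReconstruction

variable {k : ℕ}

/-! Regard an exchangeable law `ν` on the simplex as the unconditional law of a posterior vector for
a uniform colour; given that the colour is `l`, this vector has law `tilt k l ν`. The proof builds a
randomised estimator whose law given the root colour is exactly the same at every height, with `ν =
toStar k μ`.

One level of the tree. A child of a vertex of colour `l` has a uniform colour other than `l`, so its
vector has the mixture `childLaw k ν l`, whose density is proportional to `1 - x l`. This is the
likelihood that Bayes' rule multiplies over the children. Hence the posterior vector of the parent,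
given its colour `l`, has law `tilt k l (gammaS k ξ ν)` (`IsExchangeable.beliefLaw_eq_tilt`): it is
again of the assumed form, with `gammaS k ξ ν` in place of `ν`.

Returning to `ν`. The map `Λ` does not change the largest entry (`IsExchangeable.map_norm_lambda`),
so by hypothesis the largest entry under `gammaS k ξ ν` dominates `μ`. The quantile coupling lowers
this entry to a `μ`-distributed `y`. The position of the largest entry is kept with a probability
tuned to give the right colour with probability `y`, and is otherwise resampled uniformly. By
exchangeability the remaining probability spreads evenly over the wrong colours, so the resulting
star vector is its own posterior: a single kernel takes `tilt k r (gammaS k ξ ν)` to `tilt k r ν`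
for all `r` (`IsExchangeable.exists_degradation`).

The array of uniforms realises this kernel at each vertex, and at the observed level it is used to
sample from `tilt k j ν` given the colour `j`. By induction the estimator at the root has law `tilt
k r ν` given root colour `r` (`lintegral_estimator`). It therefore equals the vector of posterior
probabilities given itself (`rootBias_eq`), the bias does not depend on `n`, and it is positive
because `μ` is not the point mass at `1/k` (`integral_bias_pos`). Only plain domination enters, not
the size of the margin. -/

/-! ### Exchangeable laws on the simplex -/

/-- An exchangeable probability measure on the simplex of probability vectors. -/
structure IsExchangeable (ν : Measure (Fin k → ℝ)) : Prop where
  prob : IsProbabilityMeasure ν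
  simplex : ∀ᵐ x ∂ν, (∀ i, 0 ≤ x i) ∧ ∑ i, x i = 1
  perm : ∀ π : Equiv.Perm (Fin k), ν.map (fun x => x ∘ π) = ν

theorem measurable_comp_perm (π : Equiv.Perm (Fin k)) :
    Measurable fun x : Fin k → ℝ => x ∘ π := by
  unfold Function.comp; fun_prop

theorem IsExchangeable.lintegral_comp_perm {ν : Measure (Fin k → ℝ)} (hν : IsExchangeable ν)
    (π : Equiv.Perm (Fin k)) {f : (Fin k → ℝ) → ℝ≥0∞} (hf : Measurable f) :
    ∫⁻ x, f (x ∘ π) ∂ν = ∫⁻ x, f x ∂ν := by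
  conv_rhs => rw [← hν.perm π, lintegral_map hf (measurable_comp_perm π)]

theorem map_withDensity_comp {α β : Type*} [MeasurableSpace α] [MeasurableSpace β]
    {ν : Measure α} {g : α → β} (hg : Measurable g) {f : β → ℝ≥0∞} (hf : Measurable f) :
    (ν.withDensity fun x => f (g x)).map g = (ν.map g).withDensity f := by
  ext s hs
  rw [Measure.map_apply hg hs, withDensity_apply _ (hg hs), withDensity_apply _ hs,
    setLIntegral_map hs hf hg]

/-- By exchangeability all coordinates have the same mean, and they sum to one. This normalises the
tilts. -/
theorem IsExchangeable.lintegral_coord {ν : Measure (Fin k → ℝ)} (hν : IsExchangeable ν)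
    (l : Fin k) : ∫⁻ x, ENNReal.ofReal (k * x l) ∂ν = 1 := by
  have := hν.prob
  have h1 : ∀ j : Fin k, ∫⁻ x, ENNReal.ofReal (x j) ∂ν = ∫⁻ x, ENNReal.ofReal (x l) ∂ν := by
    intro j
    have := hν.lintegral_comp_perm (Equiv.swap l j)
      (f := fun x => ENNReal.ofReal (x l)) (by fun_prop)
    simpa using this
  have h2 : ∑ j : Fin k, ∫⁻ x, ENNReal.ofReal (x j) ∂ν = 1 := by
    rw [← lintegral_finsetSum _ (by fun_prop)]
    trans ∫⁻ _, 1 ∂ν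
    · refine lintegral_congr_ae ?_
      filter_upwards [hν.simplex] with x hx
      rw [← ENNReal.ofReal_sum_of_nonneg fun i _ => hx.1 i, hx.2, ENNReal.ofReal_one]
    · simp
  simp only [h1, Finset.sum_const, Finset.card_univ, Fintype.card_fin, nsmul_eq_mul] at h2
  rw [← h2, ← lintegral_const_mul _ (by fun_prop)]
  refine lintegral_congr fun x => ?_
  rw [ENNReal.ofReal_mul (by positivity), ENNReal.ofReal_natCast]

theorem IsExchangeable.isProbabilityMeasure_tilt {ν : Measure (Fin k → ℝ)}
    (hν : IsExchangeable ν) (l : Fin k) : IsProbabilityMeasure (tilt k l ν) := by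
  refine ⟨?_⟩
  rw [tilt, withDensity_apply _ MeasurableSet.univ, setLIntegral_univ, hν.lintegral_coord]

/-- Relabelling the colours only relabels the colour on which one conditions. -/
theorem IsExchangeable.tilt_map_perm {ν : Measure (Fin k → ℝ)} (hν : IsExchangeable ν)
    (l : Fin k) (π : Equiv.Perm (Fin k)) :
    (tilt k l ν).map (fun x => x ∘ π) = tilt k (π.symm l) ν := by
  have := map_withDensity_comp (ν := ν) (measurable_comp_perm π)
    (f := fun x => ENNReal.ofReal (k * x (π.symm l))) (by fun_prop)
  rw [hν.perm] at this
  simpa [tilt] using this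

/-! ### The law of the belief vector of a child -/

/-- The law of the belief vector of a child of a vertex of colour `l`, when the belief vector of a
vertex of colour `j` has law `tilt k j ν`. -/
def childLaw (k : ℕ) (ν : Measure (Fin k → ℝ)) (l : Fin k) : Measure (Fin k → ℝ) :=
  ν.withDensity fun x => ENNReal.ofReal (k * (1 - x l) / (k - 1))

/-- On the simplex the entries other than `x l` add up to `1 - x l`, so averaging the tilts over the
channel produces this density. -/
theorem IsExchangeable.childLaw_eq_sum (hk : 2 ≤ k) {ν : Measure (Fin k → ℝ)}
    (hν : IsExchangeable ν) (l : Fin k) :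
    childLaw k ν l =
      ∑ j, ENNReal.ofReal (if j ≠ l then 1 / ((k : ℝ) - 1) else 0) • tilt k j ν := by
  have hk' : (0 : ℝ) < k - 1 := by
    have : (2 : ℝ) ≤ k := by exact_mod_cast hk
    linarith
  have key : ∀ s : Finset (Fin k),
      ∑ j ∈ s, ENNReal.ofReal (if j ≠ l then 1 / ((k : ℝ) - 1) else 0) • tilt k j ν
      = ν.withDensity fun x => ∑ j ∈ s,
        ENNReal.ofReal (if j ≠ l then 1 / ((k : ℝ) - 1) else 0) * ENNReal.ofReal (k * x j) := by
    intro s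
    induction s using Finset.induction_on with
    | empty => simp
    | insert a s ha ih =>
      simp only [Finset.sum_insert ha, ih]
      rw [tilt, ← withDensity_smul _ (by fun_prop), ← withDensity_add_left (by fun_prop)]
      rfl
  rw [key, childLaw]
  refine withDensity_congr_ae ?_
  filter_upwards [hν.simplex] with x hx
  have h0 : ∀ j, 0 ≤ (if j ≠ l then 1 / ((k : ℝ) - 1) else 0) := by
    intro j; split_ifs <;> positivity
  simp_rw [← ENNReal.ofReal_mul (h0 _)]
  rw [← ENNReal.ofReal_sum_of_nonneg fun i _ =>
    mul_nonneg (h0 i) (mul_nonneg (by positivity) (hx.1 i))]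
  congr 1
  have : ∀ j, (if j ≠ l then 1 / ((k : ℝ) - 1) else 0) * (k * x j)
      = k / (k - 1) * (x j - if j = l then x j else 0) := by
    intro j
    by_cases h : j = l
    · simp [h]
    · simp [h]; ring
  simp_rw [this]
  rw [← Finset.mul_sum, Finset.sum_sub_distrib, hx.2, Finset.sum_ite_eq' Finset.univ l]
  simp; ring

theorem channel_univ (hk : 2 ≤ k) (l : Fin k) :
    ∑ j, ENNReal.ofReal (if j ≠ l then 1 / ((k : ℝ) - 1) else 0) = 1 := by
  have hk' : (0 : ℝ) < k - 1 := by
    have : (2 : ℝ) ≤ k := by exact_mod_cast hk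
    linarith
  have h0 : ∀ j, 0 ≤ (if j ≠ l then 1 / ((k : ℝ) - 1) else 0) := by
    intro j; split_ifs <;> positivity
  rw [← ENNReal.ofReal_sum_of_nonneg fun i _ => h0 i, ← ENNReal.ofReal_one]
  congr 1
  have : ∀ j, (if j ≠ l then 1 / ((k : ℝ) - 1) else 0)
      = 1 / (k - 1) - if j = l then 1 / ((k : ℝ) - 1) else 0 := by
    intro j; by_cases h : j = l <;> simp [h]
  simp_rw [this]
  rw [Finset.sum_sub_distrib, Finset.sum_ite_eq' Finset.univ l]
  simp
  field_simp

theorem isProbabilityMeasure_channel (hk : 2 ≤ k) (l : Fin k) :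
    IsProbabilityMeasure (channel k l) := by
  refine ⟨?_⟩
  simpa [channel] using channel_univ hk l

theorem IsExchangeable.isProbabilityMeasure_childLaw (hk : 2 ≤ k) {ν : Measure (Fin k → ℝ)}
    (hν : IsExchangeable ν) (l : Fin k) : IsProbabilityMeasure (childLaw k ν l) := by
  refine ⟨?_⟩
  rw [hν.childLaw_eq_sum hk]
  have := fun j => (hν.isProbabilityMeasure_tilt j).measure_univ
  simpa [this] using channel_univ hk l

theorem IsExchangeable.childLaw_map_perm {ν : Measure (Fin k → ℝ)} (hν : IsExchangeable ν)
    (l : Fin k) (π : Equiv.Perm (Fin k)) :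
    (childLaw k ν l).map (fun x => x ∘ π) = childLaw k ν (π.symm l) := by
  have := map_withDensity_comp (ν := ν) (measurable_comp_perm π)
    (f := fun x => ENNReal.ofReal (k * (1 - x (π.symm l)) / (k - 1))) (by fun_prop)
  rw [hν.perm] at this
  simpa [childLaw] using this

/-! ### The law of the belief vector of a parent -/

/-- The normalised product that turns the belief vectors of the children into that of the parent. -/
def posterior (k D : ℕ) (x : Fin D → Fin k → ℝ) : Fin k → ℝ :=
  fun m => (∏ i, (1 - x i m)) / ∑ m' : Fin k, ∏ i, (1 - x i m')

@[fun_prop]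
theorem measurable_posterior (k D : ℕ) : Measurable (posterior k D) := by
  unfold posterior; fun_prop

/-- The law of the belief vector of a vertex of colour `l` with `ξ`-distributed number of children,
whose belief vectors are i.i.d. with law `childLaw k ν l`. -/
def beliefLaw (k : ℕ) (ξ : Measure ℕ) (ν : Measure (Fin k → ℝ)) (l : Fin k) :
    Measure (Fin k → ℝ) :=
  Measure.sum fun D : ℕ => ξ {D} •
    (Measure.pi fun _ : Fin D => childLaw k ν l).map (posterior k D)

theorem lintegral_beliefLaw (ξ : Measure ℕ) (ν : Measure (Fin k → ℝ)) (l : Fin k)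
    {f : (Fin k → ℝ) → ℝ≥0∞} (hf : Measurable f) :
    ∫⁻ x, f x ∂(beliefLaw k ξ ν l) =
      ∑' D, ξ {D} * ∫⁻ x, f (posterior k D x) ∂(Measure.pi fun _ : Fin D => childLaw k ν l) := by
  simp only [beliefLaw, lintegral_sum_measure, lintegral_smul_measure, smul_eq_mul]
  refine tsum_congr fun D => ?_
  rw [lintegral_map hf (measurable_posterior k D)]

/-- On a box, both the density and the indicator are products over the coordinates, so independence
factorises the integral. -/
theorem pi_withDensity {α : Type*} [MeasurableSpace α] {ν : Measure α} [IsProbabilityMeasure ν]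
    {f : α → ℝ≥0∞} (hf : Measurable f) (h1 : IsProbabilityMeasure (ν.withDensity f)) (D : ℕ) :
    (Measure.pi fun _ : Fin D => ν.withDensity f) =
      (Measure.pi fun _ : Fin D => ν).withDensity fun x => ∏ i, f (x i) := by
  refine (Measure.pi_eq fun s hs => ?_)
  rw [withDensity_apply _ (MeasurableSet.univ_pi hs), ← lintegral_indicator (.univ_pi hs)]
  have h2 : ∀ x : Fin D → α, (univ.pi s).indicator (fun x => ∏ i, f (x i)) x
      = ∏ i, (s i).indicator f (x i) := by
    intro x
    by_cases h : x ∈ univ.pi s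
    · rw [indicator_of_mem h]
      exact Finset.prod_congr rfl fun i _ => (indicator_of_mem (h i trivial) _).symm
    · rw [indicator_of_notMem h]
      simp only [mem_univ_pi, not_forall] at h
      obtain ⟨i, hi⟩ := h
      exact (Finset.prod_eq_zero (Finset.mem_univ i) (indicator_of_notMem hi _)).symm
  simp_rw [h2]
  rw [lintegral_prod_eq_prod_lintegral_of_indepFun Finset.univ
    (fun i (x : Fin D → α) => (s i).indicator f (x i))
    (iIndepFun_pi (X := fun i => (s i).indicator f)
      fun i => (hf.indicator (hs i)).aemeasurable)
    fun i => (hf.indicator (hs i)).comp (measurable_pi_apply i)]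
  refine Finset.prod_congr rfl fun i _ => ?_
  rw [withDensity_apply _ (hs i), ← lintegral_indicator (hs i),
    ← (measurePreserving_eval (fun _ : Fin D => ν) i).lintegral_comp (hf.indicator (hs i))]

theorem IsExchangeable.isProbabilityMeasure_beliefLaw (hk : 2 ≤ k) (ξ : Measure ℕ)
    [IsProbabilityMeasure ξ] {ν : Measure (Fin k → ℝ)} (hν : IsExchangeable ν) (l : Fin k) :
    IsProbabilityMeasure (beliefLaw k ξ ν l) := by
  have := hν.isProbabilityMeasure_childLaw hk l
  refine ⟨?_⟩
  have h := lintegral_beliefLaw ξ ν l (f := fun _ => 1) measurable_const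
  have h2 : ∑' D : ℕ, ξ {D} = 1 := by
    have := lintegral_countable' (μ := ξ) (fun _ => 1)
    simpa using this.symm
  simpa [h2] using h

theorem IsExchangeable.beliefLaw_map_perm (hk : 2 ≤ k) (ξ : Measure ℕ)
    {ν : Measure (Fin k → ℝ)} (hν : IsExchangeable ν) (l : Fin k) (π : Equiv.Perm (Fin k)) :
    (beliefLaw k ξ ν l).map (fun x => x ∘ π) = beliefLaw k ξ ν (π.symm l) := by
  have hm := measurable_comp_perm π
  have hp := hν.isProbabilityMeasure_childLaw hk
  rw [beliefLaw, Measure.map_sum hm.aemeasurable, beliefLaw]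
  congr 1
  funext D
  rw [Measure.map_smul, Measure.map_map hm (measurable_posterior k D)]
  congr 1
  have h1 : (Measure.pi fun _ : Fin D => childLaw k ν (π.symm l)) =
      (Measure.pi fun _ : Fin D => childLaw k ν l).map fun x i => x i ∘ π := by
    rw [← hν.childLaw_map_perm l π]
    have : ∀ _ : Fin D, SigmaFinite ((childLaw k ν l).map (fun x => x ∘ π)) := by
      intro _
      rw [hν.childLaw_map_perm l π]; infer_instance
    exact (Measure.pi_map_pi (f := fun _ x => x ∘ π) fun _ => hm.aemeasurable).symm
  rw [h1, Measure.map_map (measurable_posterior k D) (by unfold Function.comp; fun_prop)]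
  congr 1
  funext x m
  simp only [posterior, Function.comp]
  congr 1
  exact (Equiv.sum_comp π fun m' => ∏ i, (1 - x i m')).symm

theorem uniformOn_eq_sum_dirac (s : Finset (Fin k)) :
    uniformOn (s : Set (Fin k)) =
      ∑ c ∈ s, (s.card : ℝ≥0∞)⁻¹ • Measure.dirac c := by
  classical
  ext t -
  rw [← Set.coe_toFinset t, uniformOn_apply_finset, Measure.finsetSum_apply]
  simp only [Measure.smul_apply, Measure.dirac_apply, smul_eq_mul]
  rw [← Finset.mul_sum, ENNReal.div_eq_inv_mul]
  congr 1
  rw [← Finset.filter_mem_eq_inter, Finset.card_filter]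
  push_cast
  exact Finset.sum_congr rfl fun c _ => by simp [Set.indicator_apply]

/-- Shifting by `c` turns the tilt at `l` into the tilt at `l + c`, and for `c` uniform over the
nonzero residues `l + c` is uniform over the colours other than `l`. This reconciles the shifts in
`Γ` with the broadcast channel. -/
theorem IsExchangeable.map_shift (hk : 2 ≤ k) {ν : Measure (Fin k → ℝ)}
    (hν : IsExchangeable ν) (l : Fin k) :
    ((uniformOn {c : Fin k | (c : ℕ) ≠ 0}).prod (tilt k l ν)).map
      (fun p m => p.2 (m - p.1)) = childLaw k ν l := by
  have : NeZero k := ⟨by omega⟩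
  have := hν.isProbabilityMeasure_tilt l
  have hS : {c : Fin k | (c : ℕ) ≠ 0} = ((Finset.univ.erase 0 : Finset (Fin k)) : Set (Fin k)) := by
    ext c
    rw [Finset.mem_coe, Finset.mem_erase]
    exact ⟨fun h => ⟨fun h' => h (by simp [h']), Finset.mem_univ c⟩,
      fun h h' => h.1 (Fin.ext (by simpa using h'))⟩
  have hm : Measurable fun (p : Fin k × (Fin k → ℝ)) (m : Fin k) => p.2 (m - p.1) :=
    measurable_from_prod_countable_right fun c => by fun_prop
  have hc : (((Finset.univ.erase 0 : Finset (Fin k)).card : ℝ≥0∞)⁻¹)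
      = ENNReal.ofReal (1 / ((k : ℝ) - 1)) := by
    have hk' : (0 : ℝ) < k - 1 := by
      have : (2 : ℝ) ≤ k := by exact_mod_cast hk
      linarith
    rw [Finset.card_erase_of_mem (Finset.mem_univ _), Finset.card_univ, Fintype.card_fin, one_div,
      ENNReal.ofReal_inv_of_pos hk', ← ENNReal.ofReal_natCast]
    push_cast [Nat.cast_sub (show 1 ≤ k by omega)]
    rfl
  refine Measure.ext_of_lintegral _ fun f hf => ?_
  rw [lintegral_map hf hm, lintegral_prod (fun p : Fin k × (Fin k → ℝ) => f fun m => p.2 (m - p.1)) (hf.comp hm).aemeasurable, hS, uniformOn_eq_sum_dirac,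
    lintegral_finsetSum_measure, hν.childLaw_eq_sum hk, lintegral_finsetSum_measure]
  simp_rw [lintegral_smul_measure, lintegral_dirac, hc]
  have h1 : ∀ c : Fin k, ∫⁻ x, f (fun m => x (m - c)) ∂(tilt k l ν)
      = ∫⁻ x, f x ∂(tilt k (l + c) ν) := by
    intro c
    have := hν.tilt_map_perm l (Equiv.subRight c)
    rw [show l + c = (Equiv.subRight c).symm l from rfl, ← this,
      lintegral_map hf (measurable_comp_perm _)]
    rfl
  simp_rw [h1]
  rw [← Equiv.sum_comp (Equiv.addLeft l)]
  symm
  rw [← Finset.sum_erase Finset.univ (a := (0 : Fin k))]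
  · refine Finset.sum_congr rfl fun c hc => ?_
    have : c ≠ 0 := (Finset.mem_erase.1 hc).1
    simp [this]
  · simp

/-- `Γ` in terms of the law of the belief vectors of the children. -/
theorem IsExchangeable.gamma_tilt (hk : 2 ≤ k) (ξ : Measure ℕ) {ν : Measure (Fin k → ℝ)}
    (hν : IsExchangeable ν) (l : Fin k) : gamma k ξ (tilt k l ν) = beliefLaw k ξ ν l := by
  have : NeZero k := ⟨by omega⟩
  have := hν.isProbabilityMeasure_tilt l
  have := hν.isProbabilityMeasure_childLaw hk l
  have : IsProbabilityMeasure (uniformOn {c : Fin k | (c : ℕ) ≠ 0}) :=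
    isProbabilityMeasure_uniformOn (Set.toFinite _) ⟨⟨1, by omega⟩, by simp⟩
  have hm : Measurable fun (p : Fin k × (Fin k → ℝ)) (m : Fin k) => p.2 (m - p.1) :=
    measurable_from_prod_countable_right fun c => by fun_prop
  unfold gamma beliefLaw
  congr 1
  funext D
  congr 1
  rw [← hν.map_shift hk l]
  have h0 : ∀ _ : Fin D, SigmaFinite (((uniformOn {c : Fin k | (c : ℕ) ≠ 0}).prod
      (tilt k l ν)).map fun p m => p.2 (m - p.1)) := by
    intro _
    rw [hν.map_shift hk l]; infer_instance
  rw [← Measure.pi_map_pi (hμ := h0) fun _ => hm.aemeasurable, Measure.map_map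
    (f := fun (x : Fin D → Fin k × (Fin k → ℝ)) i m => (x i).2 (m - (x i).1))
    (measurable_posterior k D)
    (measurable_pi_lambda _ fun i => hm.comp (measurable_pi_apply i))]
  rfl

theorem IsExchangeable.ae_le_one {ν : Measure (Fin k → ℝ)} (hν : IsExchangeable ν) :
    ∀ᵐ x ∂ν, ∀ i, x i ≤ 1 := by
  filter_upwards [hν.simplex] with x hx i
  rw [← hx.2]
  exact Finset.single_le_sum (fun j _ => hx.1 j) (Finset.mem_univ i)

/-- The constant does not depend on `l`, so the normalised likelihoods of the colours are the
entries of `posterior`. -/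
theorem IsExchangeable.pi_childLaw (hk : 2 ≤ k) {ν : Measure (Fin k → ℝ)}
    (hν : IsExchangeable ν) (l : Fin k) (D : ℕ) :
    (Measure.pi fun _ : Fin D => childLaw k ν l) =
      (Measure.pi fun _ : Fin D => ν).withDensity fun x =>
        ENNReal.ofReal ((k / (k - 1)) ^ D * ∏ i, (1 - x i l)) := by
  have := hν.prob
  have hk' : (0 : ℝ) < k - 1 := by
    have : (2 : ℝ) ≤ k := by exact_mod_cast hk
    linarith
  rw [childLaw, pi_withDensity (by fun_prop) (hν.isProbabilityMeasure_childLaw hk l)]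
  refine withDensity_congr_ae ?_
  have h : ∀ᵐ x ∂(Measure.pi fun _ : Fin D => ν), ∀ i, ∀ j, x i j ≤ 1 :=
    ae_all_iff.2 fun i =>
      (measurePreserving_eval (fun _ : Fin D => ν) i).quasiMeasurePreserving.ae
        hν.ae_le_one
  filter_upwards [h] with x hx
  rw [← ENNReal.ofReal_prod_of_nonneg]
  · congr 1
    simp_rw [mul_div_right_comm]
    rw [Finset.prod_mul_distrib]
    simp [div_pow]
  · intro i _
    have := hx i l
    have : 0 ≤ 1 - x i l := by linarith
    positivity

/-- Bayes' rule for the belief vector of the parent. -/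
theorem IsExchangeable.beliefLaw_eq_withDensity (hk : 2 ≤ k) (ξ : Measure ℕ)
    {ν : Measure (Fin k → ℝ)} (hν : IsExchangeable ν) (l : Fin k) :
    beliefLaw k ξ ν l =
      (∑ j, beliefLaw k ξ ν j).withDensity fun x => ENNReal.ofReal (x l) := by
  have := hν.prob
  have hk' : (0 : ℝ) < k - 1 := by
    have : (2 : ℝ) ≤ k := by exact_mod_cast hk
    linarith
  refine Measure.ext_of_lintegral _ fun f hf => ?_
  rw [lintegral_withDensity_eq_lintegral_mul _ (by fun_prop) hf, lintegral_finsetSum_measure,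
    lintegral_beliefLaw _ _ _ hf]
  have hg : Measurable fun x : Fin k → ℝ => ENNReal.ofReal (x l) * f x := by fun_prop
  have := fun j => lintegral_beliefLaw ξ ν j hg
  simp only [Pi.mul_apply, this]
  rw [← Summable.tsum_finsetSum fun _ _ => ENNReal.summable]
  refine tsum_congr fun D => ?_
  rw [← Finset.mul_sum]
  congr 1
  simp_rw [hν.pi_childLaw hk]
  have hfp : Measurable fun x => f (posterior k D x) := hf.comp (measurable_posterior k D)
  have hgp : Measurable fun x => ENNReal.ofReal (posterior k D x l) * f (posterior k D x) :=
    hg.comp (measurable_posterior k D)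
  rw [lintegral_withDensity_eq_lintegral_mul _ (by fun_prop) hfp]
  simp_rw [fun j : Fin k => lintegral_withDensity_eq_lintegral_mul
    (Measure.pi fun _ : Fin D => ν) (f := fun x => ENNReal.ofReal ((k / (k - 1)) ^ D *
      ∏ i, (1 - x i j))) (by fun_prop) hgp]
  rw [← lintegral_finsetSum _ fun j _ => Measurable.mul (by fun_prop) hgp]
  refine lintegral_congr_ae ?_
  have h : ∀ᵐ x ∂(Measure.pi fun _ : Fin D => ν), ∀ i, ∀ j, x i j ≤ 1 :=
    ae_all_iff.2 fun i =>
      (measurePreserving_eval (fun _ : Fin D => ν) i).quasiMeasurePreserving.ae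
        hν.ae_le_one
  filter_upwards [h] with x hx
  have h0 : ∀ j, 0 ≤ ∏ i, (1 - x i j) := fun j =>
    Finset.prod_nonneg fun i _ => by have := hx i j; linarith
  simp only [Pi.mul_apply]
  rw [← Finset.sum_mul, ← mul_assoc]
  congr 1
  rw [← ENNReal.ofReal_sum_of_nonneg fun j _ => by have := h0 j; positivity,
    ← ENNReal.ofReal_mul (Finset.sum_nonneg fun j _ => by have := h0 j; positivity),
    ← Finset.mul_sum]
  congr 1
  rw [posterior, mul_assoc]
  congr 1
  -- If the normaliser vanishes, so does each of its nonnegative summands, and the convention for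
  -- division by zero does no harm.
  by_cases hs : ∑ j, ∏ i, (1 - x i j) = 0
  · rw [hs, zero_mul]
    exact (Finset.sum_eq_zero_iff_of_nonneg fun j _ => h0 j).1 hs l (Finset.mem_univ l)
  · field_simp

theorem IsExchangeable.gammaS_eq (hk : 2 ≤ k) (ξ : Measure ℕ) {ν : Measure (Fin k → ℝ)}
    (hν : IsExchangeable ν) :
    gammaS k ξ ν = (k : ℝ≥0∞)⁻¹ • ∑ l, beliefLaw k ξ ν l := by
  rw [gammaS]
  simp_rw [hν.gamma_tilt hk]

theorem IsExchangeable.beliefLaw_eq_tilt (hk : 2 ≤ k) (ξ : Measure ℕ) {ν : Measure (Fin k → ℝ)}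
    (hν : IsExchangeable ν) (l : Fin k) :
    beliefLaw k ξ ν l = tilt k l (gammaS k ξ ν) := by
  rw [tilt, hν.gammaS_eq hk, withDensity_smul_measure, ← withDensity_smul _ (by fun_prop),
    hν.beliefLaw_eq_withDensity hk]
  congr 1
  funext x
  have : (k : ℝ≥0∞) ≠ 0 := by simp; omega
  simp only [Pi.smul_apply, smul_eq_mul]
  rw [ENNReal.ofReal_mul (by positivity), ENNReal.ofReal_natCast, ← mul_assoc,
    ENNReal.inv_mul_cancel this (ENNReal.natCast_ne_top k), one_mul]

/-- A zero normaliser would give a vector off the simplex, but there the density of the children's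
vectors is zero. -/
theorem IsExchangeable.beliefLaw_simplex (hk : 2 ≤ k) (ξ : Measure ℕ)
    {ν : Measure (Fin k → ℝ)} (hν : IsExchangeable ν) (l : Fin k) :
    ∀ᵐ x ∂(beliefLaw k ξ ν l), (∀ i, 0 ≤ x i) ∧ ∑ i, x i = 1 := by
  have := hν.prob
  have hm : MeasurableSet {x : Fin k → ℝ | (∀ i, 0 ≤ x i) ∧ ∑ i, x i = 1} := by
    measurability
  rw [beliefLaw, Measure.ae_sum_iff' hm]
  intro D
  refine Measure.ae_smul_measure ?_ _
  rw [ae_map_iff (measurable_posterior k D).aemeasurable hm, hν.pi_childLaw hk,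
    ae_withDensity_iff (by fun_prop)]
  have h : ∀ᵐ x ∂(Measure.pi fun _ : Fin D => ν), ∀ i, ∀ j, x i j ≤ 1 :=
    ae_all_iff.2 fun i =>
      (measurePreserving_eval (fun _ : Fin D => ν) i).quasiMeasurePreserving.ae
        hν.ae_le_one
  filter_upwards [h] with x hx hne
  have h0 : ∀ j, 0 ≤ ∏ i, (1 - x i j) := fun j =>
    Finset.prod_nonneg fun i _ => by have := hx i j; linarith
  refine ⟨fun m => div_nonneg (h0 m) (Finset.sum_nonneg fun j _ => h0 j), ?_⟩
  simp only [posterior]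
  rw [← Finset.sum_div, div_self]
  intro hs
  apply hne
  rw [(Finset.sum_eq_zero_iff_of_nonneg fun j _ => h0 j).1 hs l (Finset.mem_univ l)]
  simp

theorem IsExchangeable.gammaS (hk : 2 ≤ k) (ξ : Measure ℕ) [IsProbabilityMeasure ξ]
    {ν : Measure (Fin k → ℝ)} (hν : IsExchangeable ν) : IsExchangeable (gammaS k ξ ν) := by
  have hk0 : (k : ℝ≥0∞) ≠ 0 := by simp; omega
  rw [hν.gammaS_eq hk]
  refine ⟨⟨?_⟩, ?_, fun π => ?_⟩
  · have := fun l => (hν.isProbabilityMeasure_beliefLaw hk ξ l).measure_univ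
    simp [this, ENNReal.inv_mul_cancel hk0 (ENNReal.natCast_ne_top k)]
  · refine Measure.ae_smul_measure ?_ _
    rw [← Measure.sum_fintype, Measure.ae_sum_iff]
    exact hν.beliefLaw_simplex hk ξ
  · rw [Measure.map_smul, ← Measure.mapₗ_apply_of_measurable (measurable_comp_perm π), map_sum]
    simp_rw [Measure.mapₗ_apply_of_measurable (measurable_comp_perm π),
      hν.beliefLaw_map_perm hk ξ _ π]
    rw [Equiv.sum_comp π.symm]

/-! ### The quantile coupling -/

/-- The quantile function of a measure on the line. -/
def quantile (μ : Measure ℝ) (t : ℝ) : ℝ := sInf {x | t ≤ μ.real (Iic x)}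

section quantile

variable (μ : Measure ℝ) [IsProbabilityMeasure μ] {t : ℝ}

theorem quantile_set_nonempty (ht : t < 1) : {x | t ≤ μ.real (Iic x)}.Nonempty := by
  have h := (tendsto_cdf_atTop μ).eventually (lt_mem_nhds ht)
  obtain ⟨x, hx⟩ := h.exists
  exact ⟨x, by
    rw [mem_ofPred_eq, ← cdf_eq_real]
    exact hx.le⟩

theorem quantile_set_bddBelow (ht : 0 < t) : BddBelow {x | t ≤ μ.real (Iic x)} := by
  have h := (tendsto_cdf_atBot μ).eventually (gt_mem_nhds ht)
  obtain ⟨x, hx⟩ := h.exists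
  refine ⟨x, fun y (hy : t ≤ μ.real (Iic y)) => ?_⟩
  rw [← cdf_eq_real] at hy
  by_contra! hlt
  exact absurd (hy.trans (monotone_cdf μ hlt.le)) (not_le.2 hx)

/-- Right continuity of the distribution function makes the infimum attained, which gives this
Galois connection. -/
theorem quantile_le_iff (h0 : 0 < t) (h1 : t < 1) (x : ℝ) :
    quantile μ t ≤ x ↔ t ≤ μ.real (Iic x) := by
  refine ⟨fun h => ?_, fun h => csInf_le (quantile_set_bddBelow μ h0) h⟩
  have hq : t ≤ cdf μ (quantile μ t) := by
    have hc : Tendsto (cdf μ) (nhdsWithin (quantile μ t) (Ioi (quantile μ t)))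
        (nhds (cdf μ (quantile μ t))) :=
      ((cdf μ).right_continuous _).mono_left (nhdsWithin_mono _ Ioi_subset_Ici_self)
    refine ge_of_tendsto hc ?_
    filter_upwards [self_mem_nhdsWithin] with y hy
    obtain ⟨z, hz, hzy⟩ := exists_lt_of_csInf_lt (quantile_set_nonempty μ h1) hy
    have hz' : t ≤ μ.real (Iic z) := hz
    rw [← cdf_eq_real] at hz'
    exact hz'.trans (monotone_cdf μ hzy.le)
  rw [← cdf_eq_real]
  exact hq.trans (monotone_cdf μ h)

theorem aemeasurable_quantile : AEMeasurable (quantile μ) (volume.restrict (Ioo 0 1)) := by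
  refine aemeasurable_restrict_of_monotoneOn measurableSet_Ioo fun s hs t ht hst => ?_
  rw [quantile_le_iff μ hs.1 hs.2]
  exact hst.trans ((quantile_le_iff μ ht.1 ht.2 _).1 le_rfl)

theorem map_quantile : (volume.restrict (Ioo (0 : ℝ) 1)).map (quantile μ) = μ := by
  have : IsProbabilityMeasure (volume.restrict (Ioo (0 : ℝ) 1)) := ⟨by simp⟩
  have := Measure.isProbabilityMeasure_map (aemeasurable_quantile μ)
  refine Measure.ext_of_Iic _ _ fun x => ?_
  rw [Measure.map_apply_of_aemeasurable (aemeasurable_quantile μ) measurableSet_Iic,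
    Measure.restrict_apply' measurableSet_Ioo]
  have h1 : quantile μ ⁻¹' Iic x ∩ Ioo 0 1 = Iic (μ.real (Iic x)) ∩ Ioo 0 1 := by
    ext t
    refine and_congr_left fun ht => ?_
    exact quantile_le_iff μ ht.1 ht.2 x
  have h2 : (Iic (μ.real (Iic x)) ∩ Ioo 0 1 : Set ℝ) =ᵐ[volume] Ioc 0 (μ.real (Iic x)) := by
    have h3 : Iic (μ.real (Iic x)) ∩ Ioc 0 1 = Ioc 0 (μ.real (Iic x)) := by
      ext t
      have := measureReal_le_one (μ := μ) (s := Iic x)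
      simp only [mem_inter_iff, mem_Iic, mem_Ioc]
      grind
    rw [← h3]
    exact (ae_eq_refl _).inter Ioo_ae_eq_Ioc
  rw [h1, measure_congr h2, Real.volume_Ioc, sub_zero, ofReal_measureReal]

end quantile

/-- If `ν` stochastically dominates `μ`, then `μ` is the image of `ν` under a kernel that moves
points downwards. -/
theorem exists_kernel_of_stochDom (μ ν : Measure ℝ) [IsProbabilityMeasure μ]
    [IsProbabilityMeasure ν] (h : ∀ x, ν.real (Iic x) ≤ μ.real (Iic x)) :
    ∃ κ : Kernel ℝ ℝ, IsMarkovKernel κ ∧ (ν ⊗ₘ κ).snd = μ ∧ ∀ᵐ p ∂(ν ⊗ₘ κ), p.2 ≤ p.1 := by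
  have : IsProbabilityMeasure (volume.restrict (Ioo (0 : ℝ) 1)) := ⟨by simp⟩
  have hm : AEMeasurable (fun t => (quantile ν t, quantile μ t)) (volume.restrict (Ioo 0 1)) :=
    (aemeasurable_quantile ν).prodMk (aemeasurable_quantile μ)
  -- Both quantile functions are driven by the same uniform `t`; domination orders them pointwise,
  -- and the kernel is the disintegration of the joint law.
  obtain ⟨π, hπ⟩ : ∃ π, π =
    (volume.restrict (Ioo (0 : ℝ) 1)).map fun t => (quantile ν t, quantile μ t) := ⟨_, rfl⟩
  have : IsProbabilityMeasure π := hπ ▸ Measure.isProbabilityMeasure_map hm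
  have hfst : π.fst = ν := by
    rw [Measure.fst, hπ, AEMeasurable.map_map_of_aemeasurable measurable_fst.aemeasurable hm]
    exact map_quantile ν
  have hsnd : π.snd = μ := by
    rw [Measure.snd, hπ, AEMeasurable.map_map_of_aemeasurable measurable_snd.aemeasurable hm]
    exact map_quantile μ
  have hd : ν ⊗ₘ π.condKernel = π := by
    conv_lhs => rw [← hfst]
    exact π.disintegrate π.condKernel
  refine ⟨π.condKernel, inferInstance, by rw [hd, hsnd], ?_⟩
  rw [hd, hπ, ae_map_iff hm (measurableSet_le measurable_snd measurable_fst)]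
  filter_upwards [ae_restrict_mem measurableSet_Ioo] with t ht
  exact (quantile_le_iff μ ht.1 ht.2 _).2
    (((quantile_le_iff ν ht.1 ht.2 _).1 le_rfl).trans (h _))

/-! ### Symmetric laws on the star-shaped set -/

@[fun_prop]
theorem measurable_starPoint (m : Fin k) : Measurable fun y => starPoint k y m := by
  unfold starPoint
  refine measurable_pi_lambda _ fun j => ?_
  split_ifs <;> fun_prop

theorem starPoint_comp_perm (y : ℝ) (m : Fin k) (π : Equiv.Perm (Fin k)) :
    starPoint k y m ∘ π = starPoint k y (π.symm m) := by
  funext j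
  simp [starPoint, Equiv.eq_symm_apply]

theorem sum_starPoint (hk : 2 ≤ k) (y : ℝ) (m : Fin k) : ∑ j, starPoint k y m j = 1 := by
  have hk' : (0 : ℝ) < k - 1 := by
    have : (2 : ℝ) ≤ k := by exact_mod_cast hk
    linarith
  have : ∀ j, starPoint k y m j =
      (1 - y) / (k - 1) + if j = m then y - (1 - y) / (k - 1) else 0 := by
    intro j
    by_cases h : j = m <;> simp [starPoint, h]
  simp_rw [this]
  rw [Finset.sum_add_distrib, Finset.sum_ite_eq' Finset.univ m]
  simp
  field_simp
  ring

theorem starPoint_nonneg (hk : 2 ≤ k) {y : ℝ} (hy : y ∈ Icc (1 / (k : ℝ)) 1) (m j : Fin k) :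
    0 ≤ starPoint k y m j := by
  have hk' : (0 : ℝ) < k - 1 := by
    have : (2 : ℝ) ≤ k := by exact_mod_cast hk
    linarith
  have h0 : 0 ≤ y := le_trans (by positivity) hy.1
  have h1 : 0 ≤ 1 - y := by linarith [hy.2]
  unfold starPoint
  split_ifs <;> positivity

theorem measurable_starPoint_prod : Measurable fun p : ℝ × Fin k => starPoint k p.1 p.2 :=
  measurable_from_prod_countable_left fun m => measurable_starPoint m

theorem lintegral_toStar (hk : 2 ≤ k) (μ : Measure ℝ) [IsProbabilityMeasure μ]
    {f : (Fin k → ℝ) → ℝ≥0∞} (hf : Measurable f) :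
    ∫⁻ x, f x ∂(toStar k μ) = (k : ℝ≥0∞)⁻¹ * ∑ j, ∫⁻ y, f (starPoint k y j) ∂μ := by
  have : NeZero k := ⟨by omega⟩
  have : IsProbabilityMeasure (uniformOn (univ : Set (Fin k))) :=
    isProbabilityMeasure_uniformOn Set.finite_univ univ_nonempty
  have hf' : Measurable fun p : ℝ × Fin k => f (starPoint k p.1 p.2) :=
    hf.comp measurable_starPoint_prod
  rw [toStar, lintegral_map hf measurable_starPoint_prod, lintegral_prod_symm' _ hf', ← Finset.coe_univ,
    uniformOn_eq_sum_dirac, lintegral_finsetSum_measure, Finset.mul_sum]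
  simp_rw [lintegral_smul_measure, lintegral_dirac]
  simp

theorem isExchangeable_toStar (hk : 2 ≤ k) (μ : Measure ℝ) [IsProbabilityMeasure μ]
    (hμ : μ (Icc (1 / (k : ℝ)) 1)ᶜ = 0) : IsExchangeable (toStar k μ) := by
  have hk0 : (k : ℝ≥0∞) ≠ 0 := by simp; omega
  refine ⟨⟨?_⟩, ?_, fun π => ?_⟩
  · rw [← lintegral_one, lintegral_toStar hk μ measurable_const]
    simp [ENNReal.inv_mul_cancel hk0 (ENNReal.natCast_ne_top k)]
  · have : NeZero k := ⟨by omega⟩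
    have : IsProbabilityMeasure (uniformOn (univ : Set (Fin k))) :=
      isProbabilityMeasure_uniformOn Set.finite_univ univ_nonempty
    have hm : MeasurableSet {x : Fin k → ℝ | (∀ i, 0 ≤ x i) ∧ ∑ i, x i = 1} := by
      measurability
    rw [toStar, ae_map_iff measurable_starPoint_prod.aemeasurable hm]
    have : ∀ᵐ p ∂(μ.prod (uniformOn (univ : Set (Fin k)))), p.1 ∈ Icc (1 / (k : ℝ)) 1 :=
      Measure.quasiMeasurePreserving_fst.ae hμ
    filter_upwards [this] with p hp
    exact ⟨fun j => starPoint_nonneg hk hp _ j, sum_starPoint hk _ _⟩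
  · refine Measure.ext_of_lintegral _ fun f hf => ?_
    have hf' : Measurable fun x : Fin k → ℝ => f (x ∘ π) := hf.comp (measurable_comp_perm π)
    rw [lintegral_map hf (measurable_comp_perm π), lintegral_toStar hk μ hf', lintegral_toStar hk μ hf]
    simp_rw [starPoint_comp_perm]
    rw [Equiv.sum_comp π.symm fun j => ∫⁻ y, f (starPoint k y j) ∂μ]

/-! ### The selection of a largest entry -/

open Classical in
/-- The weights of the uniform distribution on the set of the largest entries of a vector. -/
def argmaxWeight (x : Fin k → ℝ) (j : Fin k) : ℝ :=
  (if ∀ i, x i ≤ x j then 1 else 0) / ∑ j', if ∀ i, x i ≤ x j' then 1 else 0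

@[fun_prop]
theorem measurable_argmaxWeight (j : Fin k) : Measurable fun x => argmaxWeight x j := by
  have h : ∀ j : Fin k, MeasurableSet {x : Fin k → ℝ | ∀ i, x i ≤ x j} := fun j => by
    measurability
  unfold argmaxWeight
  exact (Measurable.ite (h j) measurable_const measurable_const).div
    (Finset.measurable_fun_sum _ fun i _ => Measurable.ite (h i) measurable_const measurable_const)

theorem argmaxWeight_nonneg (x : Fin k → ℝ) (j : Fin k) : 0 ≤ argmaxWeight x j := by
  unfold argmaxWeight
  positivity

theorem sum_argmaxWeight [NeZero k] (x : Fin k → ℝ) : ∑ j, argmaxWeight x j = 1 := by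
  unfold argmaxWeight
  rw [← Finset.sum_div, div_self]
  obtain ⟨j, hj⟩ := Finite.exists_max x
  refine (Finset.sum_pos' (fun i _ => by positivity) ⟨j, Finset.mem_univ j, ?_⟩).ne'
  simp [hj]

theorem argmaxWeight_comp_perm (x : Fin k → ℝ) (π : Equiv.Perm (Fin k)) (j : Fin k) :
    argmaxWeight (x ∘ π) j = argmaxWeight x (π j) := by
  classical
  have h : ∀ j, (∀ i, (x ∘ π) i ≤ (x ∘ π) j) ↔ ∀ i, x i ≤ x (π j) := fun j =>
    ⟨fun h i => by simpa using h (π.symm i), fun h i => h (π i)⟩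
  unfold argmaxWeight
  simp_rw [h]
  congr 1
  exact Equiv.sum_comp π fun j => if ∀ i, x i ≤ x j then (1 : ℝ) else 0

theorem norm_comp_perm (x : Fin k → ℝ) (π : Equiv.Perm (Fin k)) : ‖x ∘ π‖ = ‖x‖ := by
  refine le_antisymm ?_ ?_
  · exact (pi_norm_le_iff_of_nonneg (norm_nonneg _)).2 fun i => norm_le_pi_norm x (π i)
  · exact (pi_norm_le_iff_of_nonneg (norm_nonneg _)).2 fun i => by
      simpa using norm_le_pi_norm (x ∘ π) (π.symm i)

theorem norm_eq_of_forall_le {x : Fin k → ℝ} (h0 : ∀ i, 0 ≤ x i) {j : Fin k}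
    (hj : ∀ i, x i ≤ x j) : ‖x‖ = x j := by
  refine le_antisymm ((pi_norm_le_iff_of_nonneg (h0 j)).2 fun i => ?_) ?_
  · rw [Real.norm_of_nonneg (h0 i)]
    exact hj i
  · simpa [Real.norm_of_nonneg (h0 j)] using norm_le_pi_norm x j

/-- The weights live on positions where the entry equals `‖x‖`: guessing a largest entry is right
with probability `‖x‖`. -/
theorem sum_mul_argmaxWeight [NeZero k] {x : Fin k → ℝ} (h0 : ∀ i, 0 ≤ x i) :
    ∑ j, x j * argmaxWeight x j = ‖x‖ := by
  have : ∀ j, x j * argmaxWeight x j = ‖x‖ * argmaxWeight x j := by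
    intro j
    by_cases hj : ∀ i, x i ≤ x j
    · rw [norm_eq_of_forall_le h0 hj]
    · simp [argmaxWeight, hj]
  simp_rw [this]
  rw [← Finset.mul_sum, sum_argmaxWeight, mul_one]

theorem one_div_le_norm [NeZero k] {x : Fin k → ℝ} (h1 : ∑ i, x i = 1) :
    1 / (k : ℝ) ≤ ‖x‖ := by
  have hk : (0 : ℝ) < k := by exact_mod_cast Nat.pos_of_ne_zero (NeZero.ne k)
  rw [div_le_iff₀ hk, ← h1]
  calc ∑ i, x i ≤ ∑ _ : Fin k, ‖x‖ := Finset.sum_le_sum fun i _ =>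
        (le_abs_self _).trans (norm_le_pi_norm x i)
    _ = ‖x‖ * k := by simp [mul_comm]

/-! ### Degradation -/

/-- The probability with which the position of the entry `y'` is kept when `y'` is degraded to
`y`. -/
def keepProb (k : ℕ) (y' y : ℝ) : ℝ := max 0 (min 1 ((y - 1 / k) / (y' - 1 / k)))

/-- The probability of the position `j` when the largest entry of `x` is degraded to `y`. -/
def degradeWeight (x : Fin k → ℝ) (y : ℝ) (j : Fin k) : ℝ :=
  keepProb k ‖x‖ y * argmaxWeight x j + (1 - keepProb k ‖x‖ y) / k

@[fun_prop]
theorem measurable_degradeWeight (j : Fin k) :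
    Measurable fun p : (Fin k → ℝ) × ℝ => degradeWeight p.1 p.2 j := by
  have := measurable_argmaxWeight j
  unfold degradeWeight keepProb
  fun_prop

theorem keepProb_mem (y' y : ℝ) : keepProb k y' y ∈ Icc (0 : ℝ) 1 :=
  ⟨le_max_left _ _, max_le zero_le_one (min_le_left _ _)⟩

theorem degradeWeight_nonneg (x : Fin k → ℝ) (y : ℝ) (j : Fin k) : 0 ≤ degradeWeight x y j := by
  have h := keepProb_mem (k := k) ‖x‖ y
  have := argmaxWeight_nonneg x j
  have h2 : 0 ≤ 1 - keepProb k ‖x‖ y := by linarith [h.2]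
  have h1 := h.1
  unfold degradeWeight
  positivity

theorem sum_degradeWeight [NeZero k] (x : Fin k → ℝ) (y : ℝ) : ∑ j, degradeWeight x y j = 1 := by
  have hk : (k : ℝ) ≠ 0 := by exact_mod_cast NeZero.ne k
  unfold degradeWeight
  rw [Finset.sum_add_distrib, ← Finset.mul_sum, sum_argmaxWeight]
  simp
  field_simp
  ring

theorem degradeWeight_comp_perm (x : Fin k → ℝ) (y : ℝ) (π : Equiv.Perm (Fin k)) (j : Fin k) :
    degradeWeight (x ∘ π) y j = degradeWeight x y (π j) := by
  rw [degradeWeight, degradeWeight, norm_comp_perm, argmaxWeight_comp_perm]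

/-- The guess is right with probability `‖x‖` if the position is kept and `1/k` if it is resampled;
`keepProb` solves `p * ‖x‖ + (1 - p) / k = y`. If `‖x‖ = 1/k` then `y = 1/k` too, and any `p` works.
-/
theorem sum_mul_degradeWeight [NeZero k] {x : Fin k → ℝ} (h0 : ∀ i, 0 ≤ x i)
    (h1 : ∑ i, x i = 1) {y : ℝ} (hy : 1 / (k : ℝ) ≤ y) (hyx : y ≤ ‖x‖) :
    ∑ j, x j * degradeWeight x y j = y := by
  have hp : keepProb k ‖x‖ y * (‖x‖ - 1 / k) = y - 1 / k := by
    rcases (hy.trans hyx).eq_or_lt with h | h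
    · rw [← h]
      linarith
    · have h2 : 0 < ‖x‖ - 1 / k := by linarith
      have h3 : 0 ≤ y - 1 / k := by linarith
      rw [keepProb, min_eq_right, max_eq_right, div_mul_cancel₀ _ h2.ne']
      · positivity
      · rw [div_le_one h2]; linarith
  unfold degradeWeight
  simp_rw [mul_add, mul_left_comm _ (keepProb k ‖x‖ y)]
  rw [Finset.sum_add_distrib, ← Finset.mul_sum, sum_mul_argmaxWeight h0, ← Finset.sum_mul, h1]
  linear_combination hp

/-- The kernel that replaces a vector `x` by the vector of the star-shaped set with entry `y` at the
position `j`, where `y` has law `κ ‖x‖` and `j` is chosen with probability `degradeWeight x y j`. -/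
def degradeKernel (k : ℕ) (κ : Kernel ℝ ℝ) [IsSFiniteKernel κ] :
    Kernel (Fin k → ℝ) (Fin k → ℝ) :=
  ∑ j : Fin k, ((κ.comap (fun x : Fin k → ℝ => ‖x‖) measurable_norm).withDensity
    fun x y => ENNReal.ofReal (degradeWeight x y j)).map fun y => starPoint k y j

theorem lintegral_degradeKernel (κ : Kernel ℝ ℝ) [IsSFiniteKernel κ] (x : Fin k → ℝ)
    {f : (Fin k → ℝ) → ℝ≥0∞} (hf : Measurable f) :
    ∫⁻ z, f z ∂(degradeKernel k κ x) =
      ∑ j, ∫⁻ y, ENNReal.ofReal (degradeWeight x y j) * f (starPoint k y j) ∂(κ ‖x‖) := by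
  rw [degradeKernel, _root_.sum_apply, lintegral_finsetSum_measure]
  refine Finset.sum_congr rfl fun j _ => ?_
  have hd := measurable_degradeWeight j
  have hf' : Measurable fun y => f (starPoint k y j) := hf.comp (measurable_starPoint j)
  rw [Kernel.map_apply _ (measurable_starPoint j), lintegral_map hf (measurable_starPoint j),
    Kernel.lintegral_withDensity _ (by unfold Function.uncurry; fun_prop) _ hf']
  rfl

theorem isMarkovKernel_degradeKernel [NeZero k] (κ : Kernel ℝ ℝ) [IsMarkovKernel κ] :
    IsMarkovKernel (degradeKernel k κ) := by
  refine ⟨fun x => ⟨?_⟩⟩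
  rw [← lintegral_one, lintegral_degradeKernel κ x measurable_const]
  have hd : ∀ j, Measurable fun y => degradeWeight x y j := fun j =>
    (measurable_degradeWeight j).comp (g := fun p : (Fin k → ℝ) × ℝ => degradeWeight p.1 p.2 j)
      (f := fun y => (x, y)) measurable_prodMk_left
  have h1 : ∀ y, ∑ j, ENNReal.ofReal (degradeWeight x y j) = 1 := fun y => by
    rw [← ENNReal.ofReal_sum_of_nonneg fun j _ => degradeWeight_nonneg x y j, sum_degradeWeight,
      ENNReal.ofReal_one]
  simp_rw [mul_one]
  rw [← lintegral_finsetSum Finset.univ fun j _ => (hd j).ennreal_ofReal]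
  simp_rw [h1]
  simp

/-- A joint law of a vector in the simplex and of a number in `[1/k, 1]` that is at most the largest
entry of the vector, invariant under the permutations of the entries of the vector. -/
structure IsDegradation (Θ : Measure ((Fin k → ℝ) × ℝ)) : Prop where
  simplex : ∀ᵐ p ∂Θ, (∀ i, 0 ≤ p.1 i) ∧ ∑ i, p.1 i = 1
  bounds : ∀ᵐ p ∂Θ, p.2 ∈ Icc (1 / (k : ℝ)) 1 ∧ p.2 ≤ ‖p.1‖
  perm : ∀ (π : Equiv.Perm (Fin k)) (F : (Fin k → ℝ) × ℝ → ℝ≥0∞), Measurable F →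
    ∫⁻ p, F (p.1 ∘ π, p.2) ∂Θ = ∫⁻ p, F p ∂Θ

/-- The number depends on the vector only through its norm, which permutations preserve, so
exchangeability passes to the joint law. -/
theorem IsExchangeable.isDegradation {ξ : Measure (Fin k → ℝ)}
    (hξ : IsExchangeable ξ) {μ : Measure ℝ} (hμ : μ (Icc (1 / (k : ℝ)) 1)ᶜ = 0)
    {κ : Kernel ℝ ℝ} [IsMarkovKernel κ] (hsnd : ((ξ.map fun x => ‖x‖) ⊗ₘ κ).snd = μ)
    (hle : ∀ᵐ p ∂((ξ.map fun x => ‖x‖) ⊗ₘ κ), p.2 ≤ p.1) :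
    IsDegradation (ξ ⊗ₘ κ.comap (fun x : Fin k → ℝ => ‖x‖) measurable_norm) ∧
    (ξ ⊗ₘ κ.comap (fun x : Fin k → ℝ => ‖x‖) measurable_norm).map Prod.snd = μ := by
  have := hξ.prob
  set Θ := ξ ⊗ₘ κ.comap (fun x : Fin k → ℝ => ‖x‖) measurable_norm with hΘ
  have hm : Measurable fun p : (Fin k → ℝ) × ℝ => (‖p.1‖, p.2) := by fun_prop
  have hmap : Θ.map (fun p => (‖p.1‖, p.2)) = (ξ.map fun x => ‖x‖) ⊗ₘ κ := by
    refine Measure.ext_of_lintegral _ fun f hf => ?_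
    have : IsProbabilityMeasure (ξ.map fun x => ‖x‖) :=
      Measure.isProbabilityMeasure_map measurable_norm.aemeasurable
    have hf' : Measurable fun p : (Fin k → ℝ) × ℝ => f (‖p.1‖, p.2) := hf.comp hm
    rw [lintegral_map hf hm, hΘ, Measure.lintegral_compProd hf',
      Measure.lintegral_compProd hf, lintegral_map hf.lintegral_kernel_prod_right' measurable_norm]
    rfl
  have hsnd' : Θ.map Prod.snd = μ := by
    rw [← hsnd, ← hmap, Measure.snd, Measure.map_map measurable_snd hm]
    rfl
  refine ⟨⟨?_, ?_, fun π F hF => ?_⟩, hsnd'⟩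
  · have hfst : Θ.map Prod.fst = ξ := Measure.fst_compProd _ _
    have h := hξ.simplex
    rw [← hfst] at h
    exact ae_of_ae_map measurable_fst.aemeasurable h
  · have h1 : ∀ᵐ y ∂(Θ.map Prod.snd), y ∈ Icc (1 / (k : ℝ)) 1 := by
      rw [hsnd']
      exact hμ
    rw [← hmap] at hle
    filter_upwards [ae_of_ae_map measurable_snd.aemeasurable h1, ae_of_ae_map hm.aemeasurable hle]
      with p hp1 hp2
    exact ⟨hp1, hp2⟩
  · have hF' : Measurable fun p : (Fin k → ℝ) × ℝ => F (p.1 ∘ π, p.2) :=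
      hF.comp (((measurable_comp_perm π).comp measurable_fst).prodMk measurable_snd)
    rw [hΘ, Measure.lintegral_compProd hF', Measure.lintegral_compProd hF,
      ← hξ.lintegral_comp_perm π hF.lintegral_kernel_prod_right']
    simp only [Kernel.comap_apply, norm_comp_perm]

theorem IsDegradation.average {Θ : Measure ((Fin k → ℝ) × ℝ)} (hΘ : IsDegradation Θ)
    (S : Finset (Fin k)) {g : Fin k → (Fin k → ℝ) × ℝ → ℝ≥0∞} (hg : ∀ j, Measurable (g j))
    (hperm : ∀ i ∈ S, ∀ j ∈ S, ∀ p, g j (p.1 ∘ Equiv.swap i j, p.2) = g i p) {j : Fin k}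
    (hj : j ∈ S) :
    (S.card : ℝ≥0∞) * ∫⁻ p, g j p ∂Θ = ∫⁻ p, ∑ i ∈ S, g i p ∂Θ := by
  rw [lintegral_finsetSum _ fun i _ => hg i, ← nsmul_eq_mul, ← Finset.sum_const]
  refine Finset.sum_congr rfl fun i hi => ?_
  rw [← hΘ.perm (Equiv.swap i j) _ (hg j)]
  exact lintegral_congr fun p => hperm i hi j hj p

/-- Conditionally on `y`, the chosen position is the true colour with probability `y`. By symmetry
the `k - 1` wrong colours share `1 - y` equally, which gives exactly the entries of a star vector.
-/
theorem IsDegradation.lintegral_coord_mul (hk : 2 ≤ k) {Θ : Measure ((Fin k → ℝ) × ℝ)}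
    (hΘ : IsDegradation Θ) (r j : Fin k) {h : ℝ → ℝ≥0∞} (hh : Measurable h) :
    ∫⁻ p, ENNReal.ofReal (k * p.1 r) * (ENNReal.ofReal (degradeWeight p.1 p.2 j) * h p.2) ∂Θ =
      ∫⁻ p, ENNReal.ofReal (starPoint k p.2 j r) * h p.2 ∂Θ := by
  have : NeZero k := ⟨by omega⟩
  have hk' : (0 : ℝ) < k - 1 := by
    have : (2 : ℝ) ≤ k := by exact_mod_cast hk
    linarith
  have hd := measurable_degradeWeight (k := k)
  have hkE : ENNReal.ofReal (k : ℝ) = k := ENNReal.ofReal_natCast k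
  have hle : ∀ {x : Fin k → ℝ}, (∀ i, 0 ≤ x i) → ∑ i, x i = 1 → ∀ i, x i ≤ 1 := fun h0 h1 i => by
    rw [← h1]
    exact Finset.single_le_sum (fun j _ => h0 j) (Finset.mem_univ i)
  by_cases hrj : r = j
  · subst hrj
    have hav := hΘ.average Finset.univ
      (g := fun i p => ENNReal.ofReal (p.1 i * degradeWeight p.1 p.2 i) * h p.2)
      (fun i => by have := hd i; fun_prop)
      (fun i _ j _ p => by
        simp only [degradeWeight_comp_perm, Function.comp, Equiv.swap_apply_right])
      (Finset.mem_univ r)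
    rw [Finset.card_univ, Fintype.card_fin,
      ← lintegral_const_mul _ (by have := hd r; fun_prop)] at hav
    trans ∫⁻ p, (k : ℝ≥0∞) * (ENNReal.ofReal (p.1 r * degradeWeight p.1 p.2 r) * h p.2) ∂Θ
    · refine lintegral_congr_ae ?_
      filter_upwards [hΘ.simplex] with p hp
      rw [ENNReal.ofReal_mul (by positivity), hkE, ENNReal.ofReal_mul (hp.1 r)]
      ring
    · rw [hav]
      refine lintegral_congr_ae ?_
      filter_upwards [hΘ.simplex, hΘ.bounds] with p hp hb
      rw [← Finset.sum_mul, ← ENNReal.ofReal_sum_of_nonneg fun i _ =>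
        mul_nonneg (hp.1 i) (degradeWeight_nonneg _ _ _),
        sum_mul_degradeWeight hp.1 hp.2 hb.1.1 hb.2]
      simp [starPoint]
  -- Swaps of positions other than `j` fix the weight at `j`, so all colours `r ≠ j` contribute
  -- equally and together give `1 - p.1 j`; `hav2` then averages over `j`.
  · have hav := hΘ.average (Finset.univ.erase j)
      (g := fun i p => ENNReal.ofReal (p.1 i * degradeWeight p.1 p.2 j) * h p.2)
      (fun i => by have := hd j; fun_prop)
      (fun i hi i' hi' p => by
        simp only [degradeWeight_comp_perm, Function.comp_apply, Equiv.swap_apply_right,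
          Equiv.swap_apply_of_ne_of_ne (Finset.ne_of_mem_erase hi).symm
            (Finset.ne_of_mem_erase hi').symm])
      (Finset.mem_erase.2 ⟨hrj, Finset.mem_univ r⟩)
    have hav2 := hΘ.average Finset.univ
      (g := fun i p => ENNReal.ofReal ((1 - p.1 i) * degradeWeight p.1 p.2 i) * h p.2)
      (fun i => by have := hd i; fun_prop)
      (fun i _ j _ p => by
        simp only [degradeWeight_comp_perm, Function.comp, Equiv.swap_apply_right])
      (Finset.mem_univ j)
    have h1 : ∫⁻ p, ∑ i ∈ Finset.univ.erase j,
        ENNReal.ofReal (p.1 i * degradeWeight p.1 p.2 j) * h p.2 ∂Θ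
        = ∫⁻ p, ENNReal.ofReal ((1 - p.1 j) * degradeWeight p.1 p.2 j) * h p.2 ∂Θ := by
      refine lintegral_congr_ae ?_
      filter_upwards [hΘ.simplex] with p hp
      rw [← Finset.sum_mul, ← ENNReal.ofReal_sum_of_nonneg fun i _ =>
        mul_nonneg (hp.1 i) (degradeWeight_nonneg _ _ _), ← Finset.sum_mul,
        Finset.sum_erase_eq_sub (Finset.mem_univ j), hp.2]
    have h2 : ∫⁻ p, ∑ i, ENNReal.ofReal ((1 - p.1 i) * degradeWeight p.1 p.2 i) * h p.2 ∂Θ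
        = ∫⁻ p, ENNReal.ofReal (1 - p.2) * h p.2 ∂Θ := by
      refine lintegral_congr_ae ?_
      filter_upwards [hΘ.simplex, hΘ.bounds] with p hp hb
      rw [← Finset.sum_mul, ← ENNReal.ofReal_sum_of_nonneg fun i _ =>
        mul_nonneg (by linarith [hle hp.1 hp.2 i]) (degradeWeight_nonneg _ _ _)]
      simp_rw [sub_mul, one_mul]
      rw [Finset.sum_sub_distrib, sum_degradeWeight,
        sum_mul_degradeWeight hp.1 hp.2 hb.1.1 hb.2]
    have hc : ((Finset.univ.erase j : Finset (Fin k)).card : ℝ≥0∞)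
        = ENNReal.ofReal ((k : ℝ) - 1) := by
      rw [Finset.card_erase_of_mem (Finset.mem_univ _), Finset.card_univ, Fintype.card_fin,
        ← ENNReal.ofReal_natCast]
      push_cast [Nat.cast_sub (show 1 ≤ k by omega)]
      rfl
    rw [hc, h1] at hav
    rw [Finset.card_univ, Fintype.card_fin, h2, ← hav] at hav2
    have hne : ENNReal.ofReal ((k : ℝ) - 1) ≠ 0 := by simpa using hk'
    rw [← ENNReal.mul_right_inj hne ENNReal.ofReal_ne_top]
    trans ∫⁻ p, ENNReal.ofReal (1 - p.2) * h p.2 ∂Θ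
    · rw [← hav2, mul_left_comm]
      congr 1
      rw [← lintegral_const_mul _ (by have := hd j; fun_prop)]
      refine lintegral_congr_ae ?_
      filter_upwards [hΘ.simplex] with p hp
      rw [ENNReal.ofReal_mul (by positivity), hkE, ENNReal.ofReal_mul (hp.1 r)]
      ring
    · simp only [starPoint, hrj, if_false]
      rw [← lintegral_const_mul _ (by fun_prop)]
      refine lintegral_congr fun p => ?_
      rw [← mul_assoc, ← ENNReal.ofReal_mul hk'.le]
      congr 2
      field_simp

/-- A star-shaped law that is dominated by an exchangeable law is obtained from the latter by a
kernel that is compatible with the tilts. -/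
theorem IsExchangeable.exists_degradation (hk : 2 ≤ k) {ξ : Measure (Fin k → ℝ)}
    (hξ : IsExchangeable ξ) {μ : Measure ℝ} [IsProbabilityMeasure μ]
    (hμ : μ (Icc (1 / (k : ℝ)) 1)ᶜ = 0)
    (hdom : ∀ x, (ξ.map fun x => ‖x‖).real (Iic x) ≤ μ.real (Iic x)) :
    ∃ G : Kernel (Fin k → ℝ) (Fin k → ℝ), IsMarkovKernel G ∧
      ∀ r, (tilt k r ξ).bind G = tilt k r (toStar k μ) := by
  have : NeZero k := ⟨by omega⟩
  have := hξ.prob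
  have : IsProbabilityMeasure (ξ.map fun x => ‖x‖) :=
    Measure.isProbabilityMeasure_map measurable_norm.aemeasurable
  obtain ⟨κ, hκ, hsnd, hle⟩ := exists_kernel_of_stochDom μ _ hdom
  obtain ⟨hΘ, hΘμ⟩ := hξ.isDegradation hμ hsnd hle
  refine ⟨degradeKernel k κ, isMarkovKernel_degradeKernel κ, fun r => ?_⟩
  refine Measure.ext_of_lintegral _ fun f hf => ?_
  have hf' : ∀ j : Fin k, Measurable fun y => f (starPoint k y j) := fun j =>
    hf.comp (measurable_starPoint j)
  have hd := measurable_degradeWeight (k := k)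
  rw [Measure.lintegral_bind (Kernel.aemeasurable _) hf.aemeasurable, tilt,
    lintegral_withDensity_eq_lintegral_mul _ (by fun_prop) hf.lintegral_kernel, tilt,
    lintegral_withDensity_eq_lintegral_mul _ (by fun_prop) hf, lintegral_toStar hk μ (by fun_prop),
    Finset.mul_sum]
  simp only [Pi.mul_apply, lintegral_degradeKernel κ _ hf, Finset.mul_sum]
  have hI : ∀ j, Measurable fun x : Fin k → ℝ => ∫⁻ y, ENNReal.ofReal (degradeWeight x y j) *
      f (starPoint k y j) ∂(κ ‖x‖) := fun j => by
    have hm : Measurable fun p : (Fin k → ℝ) × ℝ =>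
      ENNReal.ofReal (degradeWeight p.1 p.2 j) * f (starPoint k p.2 j) :=
        (hd j).ennreal_ofReal.mul ((hf' j).comp measurable_snd)
    exact hm.lintegral_kernel_prod_right'
      (κ := κ.comap (fun x : Fin k → ℝ => ‖x‖) measurable_norm)
  rw [lintegral_finsetSum _ fun j _ => by have := hI j; fun_prop]
  refine Finset.sum_congr rfl fun j _ => ?_
  have hkey := hΘ.lintegral_coord_mul hk r j (hf' j)
  have hm : Measurable fun p : (Fin k → ℝ) × ℝ => ENNReal.ofReal (k * p.1 r) *
      (ENNReal.ofReal (degradeWeight p.1 p.2 j) * f (starPoint k p.2 j)) :=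
    Measurable.mul (by fun_prop) ((hd j).ennreal_ofReal.mul ((hf' j).comp measurable_snd))
  rw [Measure.lintegral_compProd hm] at hkey
  trans ∫⁻ x, ∫⁻ y, ENNReal.ofReal (k * x r) * (ENNReal.ofReal (degradeWeight x y j) *
      f (starPoint k y j)) ∂(κ ‖x‖) ∂ξ
  · refine lintegral_congr fun x => ?_
    have h1 : Measurable fun y => degradeWeight x y j :=
      (hd j).comp (g := fun p : (Fin k → ℝ) × ℝ => degradeWeight p.1 p.2 j)
        (f := fun y => (x, y)) measurable_prodMk_left
    have h2 : Measurable fun y => ENNReal.ofReal (degradeWeight x y j) * f (starPoint k y j) :=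
      h1.ennreal_ofReal.mul (hf' j)
    rw [lintegral_const_mul _ h2]
  · refine hkey.trans ?_
    have hs : Measurable fun y => ENNReal.ofReal (starPoint k y j r) * f (starPoint k y j) :=
      ((measurable_pi_apply r).comp (measurable_starPoint j)).ennreal_ofReal.mul (hf' j)
    have h2 := lintegral_map (μ := ξ ⊗ₘ κ.comap (fun x : Fin k → ℝ => ‖x‖) measurable_norm)
      hs measurable_snd
    rw [hΘμ] at h2
    rw [← h2, ← lintegral_const_mul]
    · refine lintegral_congr fun y => ?_
      have hk0 : (k : ℝ≥0∞) ≠ 0 := by simp; omega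
      rw [ENNReal.ofReal_mul (by positivity), ENNReal.ofReal_natCast, ← mul_assoc, ← mul_assoc,
        ENNReal.inv_mul_cancel hk0 (ENNReal.natCast_ne_top k), one_mul]
    · have := ((measurable_pi_apply r).comp (measurable_starPoint j))
      exact Measurable.mul (by fun_prop) (hf' j)

/-! ### Products of infinitely many copies of a measure -/

section infinitePi

variable {A C J : Type*} [MeasurableSpace A] [MeasurableSpace C]

/-- The product of `Option J` copies splits into one copy and `J` copies. -/
theorem map_infinitePi_option (α : Measure A) [IsProbabilityMeasure α] :
    (Measure.infinitePi fun _ : Option J => α).map (fun g => (g none, fun j => g (some j))) =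
      α.prod (Measure.infinitePi fun _ : J => α) := by
  have hm : Measurable fun (p : A × (J → A)) (o : Option J) => o.elim p.1 p.2 := by
    refine measurable_pi_lambda _ fun o => ?_
    cases o
    · exact measurable_fst
    · exact (measurable_pi_apply _).comp measurable_snd
  have h : (α.prod (Measure.infinitePi fun _ : J => α)).map
      (fun p (o : Option J) => o.elim p.1 p.2) = Measure.infinitePi fun _ : Option J => α := by
    refine Measure.eq_infinitePi _ fun s t ht => ?_
    rw [Measure.map_apply hm (.pi s.countable_toSet fun i _ => ht i)]
    by_cases hs : none ∈ s
    · have hs' : s = Finset.insertNone (Finset.eraseNone s) := by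
        ext (_ | x) <;> simp [hs]
      have hpre : (fun (p : A × (J → A)) (o : Option J) => o.elim p.1 p.2) ⁻¹' (s : Set _).pi t =
          t none ×ˢ (Finset.eraseNone s : Set J).pi fun j => t (some j) := by
        ext p
        simp only [mem_preimage, Set.mem_pi, Finset.mem_coe, mem_prod, Finset.mem_eraseNone]
        exact ⟨fun h => ⟨h none hs, fun j hj => h (some j) hj⟩,
          fun h o ho => by cases o with
            | none => exact h.1
            | some j => exact h.2 j ho⟩
      rw [hpre, Measure.prod_prod, Measure.infinitePi_pi _ fun j _ => ht _]
      conv_rhs => rw [hs', Finset.prod_insertNone]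
    · have hs' : s = (Finset.eraseNone s).map Function.Embedding.some := by
        ext (_ | x) <;> simp [hs]
      have hpre : (fun (p : A × (J → A)) (o : Option J) => o.elim p.1 p.2) ⁻¹' (s : Set _).pi t =
          univ ×ˢ (Finset.eraseNone s : Set J).pi fun j => t (some j) := by
        ext p
        simp only [mem_preimage, Set.mem_pi, Finset.mem_coe, mem_prod, Finset.mem_eraseNone,
          mem_univ, true_and]
        exact ⟨fun h j hj => h (some j) hj,
          fun h o ho => by cases o with
            | none => exact absurd ho hs
            | some j => exact h j ho⟩
      rw [hpre, Measure.prod_prod, Measure.infinitePi_pi _ fun j _ => ht _, measure_univ, one_mul]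
      conv_rhs => rw [hs', Finset.prod_map]
      rfl
  rw [← h, Measure.map_map (by fun_prop) hm]
  exact Measure.map_id

/-- A product of product measures is the product of the products. -/
theorem map_infinitePi_prod (α : Measure A) (γ : Measure C) [IsProbabilityMeasure α]
    [IsProbabilityMeasure γ] :
    (Measure.infinitePi fun _ : J => α.prod γ).map (fun g => (fun j => (g j).1, fun j => (g j).2)) =
      (Measure.infinitePi fun _ : J => α).prod (Measure.infinitePi fun _ : J => γ) := by
  have hm : Measurable fun (p : (J → A) × (J → C)) (j : J) => (p.1 j, p.2 j) := by fun_prop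
  have h : ((Measure.infinitePi fun _ : J => α).prod (Measure.infinitePi fun _ : J => γ)).map
      (fun p j => (p.1 j, p.2 j)) = Measure.infinitePi fun _ : J => α.prod γ := by
    refine Measure.eq_infinitePi _ fun s t ht => ?_
    -- A box sees only the coordinates in `s`, so the splitting of finite products suffices.
    have hr : ((Measure.infinitePi fun _ : J => α).prod (Measure.infinitePi fun _ : J => γ)).map
        (Prod.map s.restrict s.restrict) =
        (Measure.pi fun _ : s => α).prod (Measure.pi fun _ : s => γ) := by
      rw [← Measure.map_prod_map _ _ (by fun_prop) (by fun_prop), Measure.infinitePi_map_restrict,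
        Measure.infinitePi_map_restrict]
    have hpi := (measurePreserving_arrowProdEquivProdArrow A C s (fun _ => α) (fun _ => γ)).map_eq
    have hpi' := congrArg (Measure.map (MeasurableEquiv.arrowProdEquivProdArrow A C s).symm) hpi
    rw [MeasurableEquiv.map_symm_map] at hpi'
    have hts : MeasurableSet (univ.pi fun j : s => t j) := .univ_pi fun j => ht _
    have hpt := congrArg (fun m => m (univ.pi fun j : s => t j)) hpi'
    simp only [Measure.pi_pi] at hpt
    rw [← hr, MeasurableEquiv.map_apply, Measure.map_apply (by fun_prop)
      ((MeasurableEquiv.measurable _) hts)] at hpt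
    rw [Measure.map_apply hm (.pi s.countable_toSet fun i _ => ht i),
      ← Finset.prod_coe_sort s fun i => (α.prod γ) (t i), hpt]
    congr 1
    ext p
    simp [Set.mem_pi, MeasurableEquiv.arrowProdEquivProdArrow, Equiv.arrowProdEquivProdArrow]
  rw [← h, Measure.map_map (by fun_prop) hm]
  exact Measure.map_id

end infinitePi

/-! ### The environment of a vertex -/

/-- The data attached to a vertex: its number of children, the channel on the edge to its parent,
and its uniform random variable. -/
abbrev Mark (k : ℕ) : Type := ℕ × (Fin k → Fin k) × unitInterval

/-- The law of the data attached to a vertex. -/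
def markLaw (k : ℕ) (ξ : Measure ℕ) : Measure (Mark k) :=
  ξ.prod ((Measure.pi fun j : Fin k => channel k j).prod volume)

/-- The law of the data attached to all the vertices. -/
def envLaw (k : ℕ) (ξ : Measure ℕ) : Measure (Vertex → Mark k) :=
  Measure.infinitePi fun _ => markLaw k ξ

/-- The sample point with root colour `r` and environment `e`. -/
def toSample (r : Fin k) (e : Vertex → Mark k) : Sample k :=
  (fun v => (e v).1, r, fun v => (e v).2.1, fun v => (e v).2.2)

/-- The environment of the `i`-th child of the root. -/
def subEnv (i : ℕ) (e : Vertex → Mark k) : Vertex → Mark k := fun v => e (v ++ [i])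

@[fun_prop]
theorem measurable_toSample (r : Fin k) : Measurable (toSample r) := by
  unfold toSample; fun_prop

theorem isProbabilityMeasure_markLaw (hk : 2 ≤ k) (ξ : Measure ℕ) [IsProbabilityMeasure ξ] :
    IsProbabilityMeasure (markLaw k ξ) := by
  have := isProbabilityMeasure_channel hk
  unfold markLaw; infer_instance

theorem map_envLaw (hk : 2 ≤ k) (ξ : Measure ℕ) [IsProbabilityMeasure ξ] :
    (envLaw k ξ).map
      (fun e => (fun v => (e v).1, fun v => (e v).2.1, fun v => (e v).2.2)) =
    (Measure.infinitePi fun _ : Vertex => ξ).prod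
      ((Measure.infinitePi fun _ : Vertex => Measure.pi fun j : Fin k => channel k j).prod
        (Measure.infinitePi fun _ : Vertex => (volume : Measure unitInterval))) := by
  have := isProbabilityMeasure_channel hk
  rw [← map_infinitePi_prod (Measure.pi fun j : Fin k => channel k j) volume]
  conv_rhs => rw [← Measure.map_id (μ := Measure.infinitePi fun _ : Vertex => ξ)]
  rw [Measure.map_prod_map _ _ measurable_id (by fun_prop), ← map_infinitePi_prod,
    Measure.map_map (by fun_prop) (by fun_prop)]
  rfl

theorem lintegral_law (hk : 2 ≤ k) (ξ : Measure ℕ) [IsProbabilityMeasure ξ]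
    {f : Sample k → ℝ≥0∞} (hf : Measurable f) :
    ∫⁻ ω, f ω ∂(law k ξ) =
      (k : ℝ≥0∞)⁻¹ * ∑ r, ∫⁻ e, f (toSample r e) ∂(envLaw k ξ) := by
  have := isProbabilityMeasure_channel hk
  have : NeZero k := ⟨by omega⟩
  have : IsProbabilityMeasure (uniformOn (univ : Set (Fin k))) :=
    isProbabilityMeasure_uniformOn Set.finite_univ univ_nonempty
  have h1 : ∀ r : Fin k, ∫⁻ e, f (toSample r e) ∂(envLaw k ξ) =
      ∫⁻ N, ∫⁻ W, f (N, r, W) ∂((Measure.infinitePi fun _ : Vertex =>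
        Measure.pi fun j : Fin k => channel k j).prod
        (Measure.infinitePi fun _ : Vertex => (volume : Measure unitInterval)))
        ∂(Measure.infinitePi fun _ : Vertex => ξ) := by
    intro r
    have hg : Measurable fun p : (Vertex → ℕ) × (Vertex → Fin k → Fin k) ×
      (Vertex → unitInterval) => f (p.1, r, p.2) := by fun_prop
    rw [← lintegral_prod _ hg.aemeasurable, ← map_envLaw hk ξ, lintegral_map hg (by fun_prop)]
    rfl
  simp_rw [h1]
  rw [law, lintegral_prod _ hf.aemeasurable, ← lintegral_finsetSum', ← lintegral_const_mul']
  · refine lintegral_congr fun N => ?_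
    rw [lintegral_prod _ (by fun_prop), ← Finset.coe_univ, uniformOn_eq_sum_dirac,
      lintegral_finsetSum_measure, Finset.mul_sum]
    simp_rw [lintegral_smul_measure, lintegral_dirac]
    simp
  · have : NeZero k := ⟨by omega⟩
    simp [NeZero.ne k]
  · intro r _
    have hg : Measurable fun p : (Vertex → ℕ) × (Vertex → Fin k → Fin k) ×
      (Vertex → unitInterval) => f (p.1, r, p.2) := by fun_prop
    exact hg.lintegral_prod_right'.aemeasurable

/-- The data of the root and the environments of its children are independent, and the latter are
distributed like the environment of the root. -/
theorem map_envLaw_root (hk : 2 ≤ k) (ξ : Measure ℕ) [IsProbabilityMeasure ξ] :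
    (envLaw k ξ).map (fun e => (e [], fun i => subEnv i e)) =
      (markLaw k ξ).prod (Measure.infinitePi fun _ : ℕ => envLaw k ξ) := by
  have := isProbabilityMeasure_markLaw hk ξ
  -- The root is `none`, and `(i, v)` is the vertex `v` of the subtree of the `i`-th child;
  -- injectivity of `φ` keeps the marks i.i.d.
  let φ : Option (ℕ × Vertex) → Vertex := fun o => o.elim [] fun p => p.2 ++ [p.1]
  have hφ : Function.Injective φ := by
    rintro (_ | ⟨i, v⟩) (_ | ⟨j, w⟩) h
    · rfl
    · simp [φ] at h
    · simp [φ] at h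
    · have h' : v ++ [i] = w ++ [j] := h
      obtain ⟨h1, h2⟩ := List.append_inj' h' rfl
      rw [h1, List.singleton_inj.1 h2]
  have h1 := Measure.map_infinitePi_infinitePi_of_inj (P := fun _ : Vertex => markLaw k ξ) hφ
  have h2 := Measure.infinitePi_map_curry fun (_ : ℕ) (_ : Vertex) => markLaw k ξ
  have h3 := map_infinitePi_option (J := ℕ × Vertex) (markLaw k ξ)
  rw [envLaw, ← h2]
  conv_rhs => enter [1]; rw [← Measure.map_id (μ := markLaw k ξ)]
  rw [Measure.map_prod_map _ _ measurable_id (by fun_prop), ← h3, ← h1,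
    Measure.map_map (by fun_prop) (by fun_prop), Measure.map_map (by fun_prop) (by fun_prop)]
  rfl

/-- The law of the data of the root and of functions of the environments of its first children. -/
theorem lintegral_envLaw_root (hk : 2 ≤ k) (ξ : Measure ℕ) [IsProbabilityMeasure ξ]
    {β : Type*} [MeasurableSpace β] {φ : Fin k → (Vertex → Mark k) → β}
    (hφ : ∀ r, Measurable (φ r)) {R : Fin k → Measure β} [∀ r, IsProbabilityMeasure (R r)]
    (hR : ∀ r, (envLaw k ξ).map (φ r) = R r) (s : (Fin k → Fin k) → Fin k)
    {F : Mark k → (ℕ → β) → ℝ≥0∞} (hF : Measurable (Function.uncurry F)) :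
    ∫⁻ e, F (e []) (fun i => φ (s (e []).2.1) (subEnv i e)) ∂(envLaw k ξ) =
      ∫⁻ m, ∫⁻ x, F m x ∂(Measure.infinitePi fun _ : ℕ => R (s m.2.1)) ∂(markLaw k ξ) := by
  have := isProbabilityMeasure_markLaw hk ξ
  have : IsProbabilityMeasure (envLaw k ξ) := by unfold envLaw; infer_instance
  have hφ' : Measurable fun p : Fin k × (Vertex → Mark k) => φ p.1 p.2 :=
    measurable_from_prod_countable_right hφ
  have hs : Measurable s := Measurable.of_discrete
  have hG : Measurable fun p : Mark k × (ℕ → Vertex → Mark k) =>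
      F p.1 (fun i => φ (s p.1.2.1) (p.2 i)) := by
    refine hF.comp (measurable_fst.prodMk (measurable_pi_lambda _ fun i => ?_))
    exact hφ'.comp ((hs.comp (by fun_prop)).prodMk (by fun_prop))
  have hm : Measurable fun e : Vertex → Mark k => (e [], fun i => subEnv i e) := by
    unfold subEnv; fun_prop
  rw [← lintegral_map (f := fun p : Mark k × (ℕ → Vertex → Mark k) =>
      F p.1 (fun i => φ (s p.1.2.1) (p.2 i))) hG hm, map_envLaw_root hk ξ,
    lintegral_prod _ hG.aemeasurable]
  refine lintegral_congr fun m => ?_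
  -- With the mark of the root fixed, its colour is a constant and the values at the children become
  -- i.i.d.
  have hR' : (Measure.infinitePi fun _ : ℕ => R (s m.2.1)) =
      (Measure.infinitePi fun _ : ℕ => envLaw k ξ).map fun g i => φ (s m.2.1) (g i) := by
    rw [Measure.infinitePi_map_pi (fun _ : ℕ => envLaw k ξ) fun _ => hφ (s m.2.1)]
    simp_rw [hR]
  have hFm : Measurable (F m) := hF.comp measurable_prodMk_left
  have hgm : Measurable fun (g : ℕ → Vertex → Mark k) (i : ℕ) => φ (s m.2.1) (g i) :=
    measurable_pi_lambda _ fun i => (hφ _).comp (measurable_pi_apply i)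
  rw [hR', lintegral_map hFm hgm]

/-! ### Observations -/

/-- The type of the triples `(T_n, σ_{L_n}, U)`. -/
abbrev Observation (k : ℕ) : Type :=
  Set Vertex × Set (Vertex × Fin k) × (Vertex → unitInterval)

theorem measurable_isVertex (v : Vertex) :
    Measurable fun ω : Sample k => IsVertex ω.1 v := by
  induction v with
  | nil => exact measurable_const
  | cons i v ih =>
    have h : MeasurableSet {ω : Sample k | i < ω.1 v} :=
      measurableSet_lt measurable_const (by fun_prop)
    exact measurableSet_setOfPred.1 ((measurableSet_setOfPred.2 ih).inter h)

theorem measurable_colour (v : Vertex) : Measurable fun ω : Sample k => colour ω v := by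
  induction v with
  | nil => exact measurable_fst.comp measurable_snd
  | cons i v ih =>
    have h : Measurable fun p : (Fin k → Fin k) × Fin k => p.1 p.2 :=
      measurable_from_prod_countable_left fun j => measurable_pi_apply j
    have h' : Measurable fun ω : Sample k => ω.2.2.1 (i :: v) := by fun_prop
    exact h.comp (h'.prodMk ih)

theorem measurable_observation (n : ℕ) :
    Measurable (observation n : Sample k → Observation k) := by
  have hv : ∀ v : Vertex, MeasurableSet {ω : Sample k | IsVertex ω.1 v} := fun v =>
    measurableSet_setOfPred.2 (measurable_isVertex v)
  refine Measurable.prodMk ?_ (Measurable.prodMk ?_ ?_)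
  · refine measurable_set_iff.2 fun v => measurableSet_setOfPred.1 ?_
    exact (hv v).inter (MeasurableSet.const _)
  · refine measurable_set_iff.2 fun q => measurableSet_setOfPred.1 ?_
    exact ((hv q.1).inter (MeasurableSet.const _)).inter
      (measurableSet_eq_fun measurable_const (measurable_colour q.1))
  · unfold uniforms; fun_prop

/-- The observation of the `i`-th child of the root. -/
def subObservation (i : ℕ) (q : Observation k) : Observation k :=
  ({v | v ++ [i] ∈ q.1}, {p | (p.1 ++ [i], p.2) ∈ q.2.1}, fun v => q.2.2 (v ++ [i]))

theorem measurable_subObservation (i : ℕ) :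
    Measurable (subObservation i : Observation k → Observation k) := by
  refine Measurable.prodMk ?_ (Measurable.prodMk ?_ ?_)
  · exact measurable_set_iff.2 fun v => (measurable_set_mem (v ++ [i])).comp measurable_fst
  · exact measurable_set_iff.2 fun p =>
      (measurable_set_mem (p.1 ++ [i], p.2)).comp (measurable_fst.comp measurable_snd)
  · fun_prop

/-- The head of a list is the last step away from the root, so the subtree of child `i` consists of
the lists that end in `i`. -/
theorem isVertex_append (e : Vertex → Mark k) (i : ℕ) (v : Vertex) :
    IsVertex (fun v => (e v).1) (v ++ [i]) ↔
      i < (e []).1 ∧ IsVertex (fun v => (subEnv i e v).1) v := by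
  induction v with
  | nil => simp [IsVertex]
  | cons j v ih =>
    rw [List.cons_append, IsVertex, IsVertex, ih, and_assoc]
    rfl

theorem colour_append (r : Fin k) (e : Vertex → Mark k) (i : ℕ) (v : Vertex) :
    colour (toSample r e) (v ++ [i]) =
      colour (toSample ((subEnv i e []).2.1 r) (subEnv i e)) v := by
  induction v with
  | nil => rfl
  | cons j v ih => rw [List.cons_append, colour, ih, colour]; rfl

theorem subObservation_observation (n : ℕ) (r : Fin k) (e : Vertex → Mark k) {i : ℕ}
    (hi : i < (e []).1) :
    subObservation i (observation (n + 1) (toSample r e)) =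
      observation n (toSample ((subEnv i e []).2.1 r) (subEnv i e)) := by
  have h := isVertex_append e i
  refine Prod.ext ?_ (Prod.ext ?_ rfl)
  · ext v
    change (IsVertex (fun v => (e v).1) (v ++ [i]) ∧ (v ++ [i]).length ≤ n + 1) ↔
      (IsVertex (fun v => (subEnv i e v).1) v ∧ v.length ≤ n)
    simp [h, hi]
  · ext p
    change ((IsVertex (fun v => (e v).1) (p.1 ++ [i]) ∧ (p.1 ++ [i]).length = n + 1) ∧
        p.2 = colour (toSample r e) (p.1 ++ [i])) ↔
      ((IsVertex (fun v => (subEnv i e v).1) p.1 ∧ p.1.length = n) ∧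
        p.2 = colour (toSample ((subEnv i e []).2.1 r) (subEnv i e)) p.1)
    simp [h, hi, colour_append]

/-- The second alternative makes `childCount` total; a set with infinitely many children of the root
is never observed. -/
theorem exists_notMem_or_forall_mem (T : Set Vertex) : ∃ m, [m] ∉ T ∨ ∀ i, [i] ∈ T := by
  by_cases h : ∀ i, [i] ∈ T
  · exact ⟨0, Or.inr h⟩
  · push Not at h
    exact h.imp fun _ => Or.inl

open Classical in
/-- The number of children of the root. -/
def childCount (T : Set Vertex) : ℕ := Nat.find (exists_notMem_or_forall_mem T)

theorem measurable_childCount : Measurable childCount := by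
  classical
  refine measurable_find _ fun m => ?_
  have : ∀ i : ℕ, MeasurableSet {T : Set Vertex | [i] ∈ T} := fun i => measurableSet_setOfPred.2
    (measurable_set_mem _)
  exact (this m).compl.union (measurableSet_setOfPred.2 (Measurable.forall fun i => measurable_set_mem [i]))

theorem childCount_observation (n : ℕ) (r : Fin k) (e : Vertex → Mark k) :
    childCount (observation (n + 1) (toSample r e)).1 = (e []).1 := by
  classical
  have h : ∀ i : ℕ, [i] ∈ (observation (n + 1) (toSample r e)).1 ↔ i < (e []).1 := by
    intro i
    change ((IsVertex (fun v => (e v).1) [i] ∧ [i].length ≤ n + 1)) ↔ _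
    simp [IsVertex]
  rw [childCount, Nat.find_eq_iff]
  simp only [h]
  refine ⟨Or.inl (lt_irrefl _), fun m hm => ?_⟩
  push Not
  exact ⟨hm, (e []).1, le_rfl⟩

/-! ### The recursive estimator -/

/-- The belief vector of the root given those of its children. -/
def posteriorNat (k D : ℕ) (x : ℕ → Fin k → ℝ) : Fin k → ℝ := posterior k D fun i => x i

theorem measurable_posteriorNat :
    Measurable fun p : ℕ × (ℕ → Fin k → ℝ) => posteriorNat k p.1 p.2 :=
  measurable_from_prod_countable_right fun D =>
    (measurable_posterior k D).comp (measurable_pi_lambda _ fun i => measurable_pi_apply (i : ℕ))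

open Classical in
/-- The estimator of the belief vector of the root at height `n`: `g` is used at height `0`, where
the colour is observed, and `f` degrades the belief vector otherwise. -/
def estimator (g : Fin k → unitInterval → Fin k → ℝ)
    (f : (Fin k → ℝ) → unitInterval → Fin k → ℝ) : ℕ → Observation k → Fin k → ℝ
  | 0 => fun q => ∑ j, if ([], j) ∈ q.2.1 then g j (q.2.2 []) else 0
  | n + 1 => fun q =>
      f (posteriorNat k (childCount q.1) fun i => estimator g f n (subObservation i q)) (q.2.2 [])

variable {g : Fin k → unitInterval → Fin k → ℝ} {f : (Fin k → ℝ) → unitInterval → Fin k → ℝ}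

theorem measurable_estimator (hg : ∀ j, Measurable (g j))
    (hf : Measurable (Function.uncurry f)) (n : ℕ) : Measurable (estimator g f n) := by
  classical
  induction n with
  | zero =>
    refine Finset.measurable_fun_sum _ fun j _ => Measurable.ite ?_ ?_ measurable_const
    · exact measurableSet_setOfPred.2
        ((measurable_set_mem ([], j)).comp (measurable_fst.comp measurable_snd))
    · exact (hg j).comp (by fun_prop)
  | succ n ih =>
    refine hf.comp (Measurable.prodMk (measurable_posteriorNat.comp (Measurable.prodMk
      (measurable_childCount.comp measurable_fst) (measurable_pi_lambda _ fun i =>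
        ih.comp (measurable_subObservation i)))) (by fun_prop))

theorem estimator_zero (r : Fin k) (e : Vertex → Mark k) :
    estimator g f 0 (observation 0 (toSample r e)) = g r (e []).2.2 := by
  classical
  have h : ∀ j : Fin k, ([], j) ∈ (observation 0 (toSample r e)).2.1 ↔ j = r := by
    intro j
    change ((IsVertex (fun v => (e v).1) [] ∧ ([] : Vertex).length = 0) ∧ j = r) ↔ _
    simp [IsVertex]
  rw [estimator]
  simp only [h, Finset.sum_ite_eq' Finset.univ r, Finset.mem_univ, if_true]
  rfl

/-- The observation of child `i` is genuine only for `i` below the number of children, and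
`posteriorNat` reads no others. -/
theorem estimator_succ (n : ℕ) (r : Fin k) (e : Vertex → Mark k) :
    estimator g f (n + 1) (observation (n + 1) (toSample r e)) =
      f (posteriorNat k (e []).1 fun i => estimator g f n
        (observation n (toSample ((subEnv i e []).2.1 r) (subEnv i e)))) (e []).2.2 := by
  simp only [estimator]
  rw [childCount_observation]
  have : ∀ i : Fin (e []).1, subObservation i (observation (n + 1) (toSample r e)) =
      observation n (toSample ((subEnv i e []).2.1 r) (subEnv i e)) := fun i =>
    subObservation_observation n r e i.2
  simp only [posteriorNat, this]
  rfl

theorem map_infinitePi_fin {β : Type*} [MeasurableSpace β] (R : Measure β)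
    [IsProbabilityMeasure R] (D : ℕ) :
    (Measure.infinitePi fun _ : ℕ => R).map (fun x (i : Fin D) => x i) =
      Measure.pi fun _ : Fin D => R := by
  rw [Measure.map_infinitePi_infinitePi_of_inj (P := fun _ : ℕ => R) (f := fun i : Fin D => (i : ℕ))
    Fin.val_injective, Measure.infinitePi_eq_pi]

/-- Of the channel outputs on an edge, only the one for the parent's actual colour `r` matters. -/
theorem lintegral_pi_channel (hk : 2 ≤ k) {ν : Measure (Fin k → ℝ)} (hν : IsExchangeable ν)
    (r : Fin k) {F : (Fin k → ℝ) → ℝ≥0∞} :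
    ∫⁻ w, ∫⁻ x, F x ∂(tilt k (w r) ν) ∂(Measure.pi fun j : Fin k => channel k j) =
      ∫⁻ x, F x ∂(childLaw k ν r) := by
  have := isProbabilityMeasure_channel hk
  rw [(measurePreserving_eval (fun j : Fin k => channel k j) r).lintegral_comp
    (f := fun c => ∫⁻ x, F x ∂(tilt k c ν)) Measurable.of_discrete, channel,
    hν.childLaw_eq_sum hk, lintegral_finsetSum_measure, lintegral_finsetSum_measure]
  simp_rw [lintegral_smul_measure, lintegral_dirac]

section estimator

variable {g : Fin k → unitInterval → Fin k → ℝ} {f : (Fin k → ℝ) → unitInterval → Fin k → ℝ}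

/-- One step of the recursion, for a fixed colour of the root. -/
theorem lintegral_step (hk : 2 ≤ k) (ξ : Measure ℕ) [IsProbabilityMeasure ξ]
    {ν : Measure (Fin k → ℝ)} (hν : IsExchangeable ν)
    (hfm : Measurable (Function.uncurry f)) {G : Kernel (Fin k → ℝ) (Fin k → ℝ)}
    (hf : ∀ x, volume.map (f x) = G x)
    (hG : ∀ r, (tilt k r (gammaS k ξ ν)).bind G = tilt k r ν) (r : Fin k)
    {F : (Fin k → ℝ) → ℝ≥0∞} (hF : Measurable F) :
    ∫⁻ D, ∫⁻ u, ∫⁻ x, F (f (posteriorNat k D x) u)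
      ∂(Measure.infinitePi fun _ : ℕ => childLaw k ν r) ∂volume ∂ξ =
      ∫⁻ x, F x ∂(tilt k r ν) := by
  have := hν.isProbabilityMeasure_childLaw hk r
  have hH : Measurable fun z => ∫⁻ y, F y ∂(G z) := hF.lintegral_kernel
  rw [← hG r, Measure.lintegral_bind (Kernel.aemeasurable _) hF.aemeasurable,
    ← hν.beliefLaw_eq_tilt hk ξ r, lintegral_beliefLaw _ _ _ hH, lintegral_countable']
  refine tsum_congr fun D => ?_
  rw [mul_comm]
  congr 1
  have hm : Measurable fun (x : ℕ → Fin k → ℝ) (i : Fin D) => x i := by fun_prop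
  have hHp : Measurable fun x => ∫⁻ y, F y ∂(G (posterior k D x)) :=
    hH.comp (measurable_posterior k D)
  rw [← map_infinitePi_fin (childLaw k ν r) D, lintegral_map hHp hm]
  have hp : Measurable fun x : ℕ → Fin k → ℝ => posteriorNat k D x :=
    (measurable_posterior k D).comp hm
  -- For fixed `x` the uniform variable realises the kernel `G` at the parent's posterior.
  rw [lintegral_lintegral_swap]
  · refine lintegral_congr fun x => ?_
    rw [← hf, lintegral_map hF hfm.of_uncurry_left]
    rfl
  · exact (hF.comp (hfm.comp ((hp.comp measurable_snd).prodMk measurable_fst))).aemeasurable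

/-- The law of the estimator when the colour of the root is a function of the channel attached to
the root. -/
theorem lintegral_estimator (hk : 2 ≤ k) (ξ : Measure ℕ) [IsProbabilityMeasure ξ]
    {ν : Measure (Fin k → ℝ)} (hν : IsExchangeable ν)
    (hgm : ∀ j, Measurable (g j)) (hg : ∀ j, volume.map (g j) = tilt k j ν)
    (hfm : Measurable (Function.uncurry f)) {G : Kernel (Fin k → ℝ) (Fin k → ℝ)}
    (hf : ∀ x, volume.map (f x) = G x)
    (hG : ∀ r, (tilt k r (gammaS k ξ ν)).bind G = tilt k r ν) (n : ℕ)
    (s : (Fin k → Fin k) → Fin k) {F : (Fin k → ℝ) → ℝ≥0∞} (hF : Measurable F) :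
    ∫⁻ e, F (estimator g f n (observation n (toSample (s (e []).2.1) e))) ∂(envLaw k ξ) =
      ∫⁻ w, ∫⁻ x, F x ∂(tilt k (s w) ν) ∂(Measure.pi fun j : Fin k => channel k j) := by
  have := isProbabilityMeasure_channel hk
  have := isProbabilityMeasure_markLaw hk ξ
  have hs : Measurable s := Measurable.of_discrete
  induction n generalizing s F with
  | zero =>
    have hgj : Measurable fun p : Fin k × unitInterval => g p.1 p.2 :=
      measurable_from_prod_countable_right hgm
    have hm : Measurable fun m : Mark k => F (g (s m.2.1) m.2.2) :=
      hF.comp (hgj.comp ((hs.comp (by fun_prop)).prodMk (by fun_prop)))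
    have hm' : Measurable fun p : (Fin k → Fin k) × unitInterval => F (g (s p.1) p.2) :=
      hF.comp (hgj.comp ((hs.comp (by fun_prop)).prodMk (by fun_prop)))
    simp_rw [estimator_zero]
    have h := (measurePreserving_eval_infinitePi (fun _ : Vertex => markLaw k ξ) []).lintegral_comp
      hm
    rw [envLaw, h, markLaw, lintegral_prod _ hm.aemeasurable]
    simp only [lintegral_const, measure_univ, mul_one]
    rw [lintegral_prod _ hm'.aemeasurable]
    refine lintegral_congr fun w => ?_
    rw [← hg, lintegral_map hF (hgm _)]
  | succ n ih =>
    have hcl := hν.isProbabilityMeasure_childLaw hk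
    have hest := measurable_estimator hgm hfm n
    have hφ : ∀ r : Fin k, Measurable fun e : Vertex → Mark k =>
        estimator g f n (observation n (toSample ((e []).2.1 r) e)) := by
      intro r
      have h1 : Measurable fun p : Fin k × (Vertex → Mark k) =>
          estimator g f n (observation n (toSample p.1 p.2)) :=
        measurable_from_prod_countable_right fun c =>
          hest.comp ((measurable_observation n).comp (measurable_toSample c))
      have h2 : Measurable fun e : Vertex → Mark k => (e []).2.1 r := by fun_prop
      exact h1.comp (h2.prodMk measurable_id)
    have hR : ∀ r : Fin k, (envLaw k ξ).map (fun e =>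
        estimator g f n (observation n (toSample ((e []).2.1 r) e))) = childLaw k ν r := by
      intro r
      refine Measure.ext_of_lintegral _ fun F hF => ?_
      -- A child of a vertex of colour `r` has as its colour the value at `r` of its own channel;
      -- this is why the induction runs over all `s`.
      rw [lintegral_map hF (hφ r), ih (fun w => w r) hF Measurable.of_discrete,
        lintegral_pi_channel hk hν]
    simp_rw [estimator_succ]
    have hFm : Measurable fun p : Mark k × (ℕ → Fin k → ℝ) =>
        F (f (posteriorNat k p.1.1 p.2) p.1.2.2) :=
      hF.comp (hfm.comp (Measurable.prodMk
        (measurable_posteriorNat.comp (Measurable.prodMk (by fun_prop) (by fun_prop)))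
        (by fun_prop)))
    rw [lintegral_envLaw_root hk ξ hφ hR s
      (F := fun m x => F (f (posteriorNat k m.1 x) m.2.2)) hFm]
    have hI : ∀ r : Fin k, Measurable fun q : ℕ × unitInterval =>
        ∫⁻ x, F (f (posteriorNat k q.1 x) q.2)
          ∂(Measure.infinitePi fun _ : ℕ => childLaw k ν r) := by
      intro r
      have h1 : Measurable fun p : (ℕ × unitInterval) × (ℕ → Fin k → ℝ) =>
          F (f (posteriorNat k p.1.1 p.2) p.1.2) :=
        hF.comp (hfm.comp (Measurable.prodMk
          (measurable_posteriorNat.comp (Measurable.prodMk (by fun_prop) (by fun_prop)))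
          (by fun_prop)))
      exact h1.lintegral_prod_right'
    have hJ : Measurable fun p : (Fin k → Fin k) × (ℕ × unitInterval) =>
        ∫⁻ x, F (f (posteriorNat k p.2.1 x) p.2.2)
          ∂(Measure.infinitePi fun _ : ℕ => childLaw k ν (s p.1)) :=
      measurable_from_prod_countable_right fun w => hI (s w)
    have hm : Measurable fun m : Mark k => ∫⁻ x, F (f (posteriorNat k m.1 x) m.2.2)
        ∂(Measure.infinitePi fun _ : ℕ => childLaw k ν (s m.2.1)) :=
      hJ.comp (g := fun p : (Fin k → Fin k) × (ℕ × unitInterval) =>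
        ∫⁻ x, F (f (posteriorNat k p.2.1 x) p.2.2)
          ∂(Measure.infinitePi fun _ : ℕ => childLaw k ν (s p.1)))
        (f := fun m : Mark k => (m.2.1, m.1, m.2.2)) (by fun_prop)
    rw [markLaw, lintegral_prod _ hm.aemeasurable]
    have h2 : ∀ D : ℕ, ∫⁻ p : (Fin k → Fin k) × unitInterval,
        ∫⁻ x, F (f (posteriorNat k D x) p.2)
          ∂(Measure.infinitePi fun _ : ℕ => childLaw k ν (s p.1))
          ∂((Measure.pi fun j : Fin k => channel k j).prod volume) =
        ∫⁻ w, ∫⁻ u, ∫⁻ x, F (f (posteriorNat k D x) u)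
          ∂(Measure.infinitePi fun _ : ℕ => childLaw k ν (s w))
          ∂volume ∂(Measure.pi fun j : Fin k => channel k j) := fun D =>
      lintegral_prod _ (hm.comp (measurable_prodMk_left (x := D))).aemeasurable
    simp_rw [h2]
    rw [lintegral_lintegral_swap]
    · exact lintegral_congr fun w => lintegral_step hk ξ hν hfm hf hG (s w) hF
    · refine Measurable.aemeasurable ?_
      refine measurable_from_prod_countable_right fun D => Measurable.of_discrete

end estimator

/-! ### The law of the largest entry -/

theorem norm_starPoint (hk : 2 ≤ k) {y : ℝ} (hy : y ∈ Icc (1 / (k : ℝ)) 1) (m : Fin k) :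
    ‖starPoint k y m‖ = y := by
  have hk' : (0 : ℝ) < k - 1 := by
    have : (2 : ℝ) ≤ k := by exact_mod_cast hk
    linarith
  have hk0 : (0 : ℝ) < k := by linarith
  have h1 : (1 - y) / (k - 1) ≤ y := by
    rw [div_le_iff₀ hk']
    have := (div_le_iff₀ hk0).1 hy.1
    linarith
  rw [norm_eq_of_forall_le (starPoint_nonneg hk hy m) (j := m)]
  · simp [starPoint]
  · intro i
    by_cases h : i = m <;> simp [starPoint, h, h1]

/-- A star vector built from `y` in `[1/k, 1]` has norm `y`, and the selection weights sum to one
over the positions of the largest entries. -/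
theorem IsExchangeable.map_norm_lambda (hk : 2 ≤ k) {ξ : Measure (Fin k → ℝ)}
    (hξ : IsExchangeable ξ) :
    (lambda k ξ).map (fun x => ‖x‖) = ξ.map fun x => ‖x‖ := by
  classical
  have : NeZero k := ⟨by omega⟩
  refine Measure.ext_of_lintegral _ fun F hF => ?_
  have hFn : Measurable fun x : Fin k → ℝ => F ‖x‖ := hF.comp measurable_norm
  have hE : ∀ m : Fin k, MeasurableSet {x : Fin k → ℝ | x m = ‖x‖} := fun m =>
    measurableSet_eq_fun (by fun_prop) (by fun_prop)
  have hw : ∀ m : Fin k, Measurable fun x : Fin k → ℝ => if x m = ‖x‖ then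
      ((Finset.univ.filter fun j => x j = ‖x‖).card : ℝ≥0∞)⁻¹ else 0 := by
    intro m
    refine Measurable.ite (hE m) (Measurable.inv ?_) measurable_const
    simp_rw [Finset.card_filter]
    push_cast
    exact Finset.measurable_fun_sum _ fun j _ =>
      Measurable.ite (hE j) measurable_const measurable_const
  have hs : ∀ m : Fin k, Measurable fun x : Fin k → ℝ => starPoint k ‖x‖ m := fun m =>
    (measurable_starPoint m).comp measurable_norm
  have hFs : ∀ m : Fin k, Measurable fun x : Fin k → ℝ => F ‖starPoint k ‖x‖ m‖ := fun m =>
    hFn.comp (hs m)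
  have hlam : lambda k ξ = ∑ m : Fin k, (ξ.withDensity fun x => if x m = ‖x‖ then
      ((Finset.univ.filter fun j => x j = ‖x‖).card : ℝ≥0∞)⁻¹ else 0).map
      fun x => starPoint k ‖x‖ m := by
    unfold lambda
    congr!
  rw [lintegral_map hF measurable_norm, lintegral_map hF measurable_norm, hlam,
    lintegral_finsetSum_measure]
  simp_rw [fun m => lintegral_map (μ := ξ.withDensity fun x => if x m = ‖x‖ then
      ((Finset.univ.filter fun j => x j = ‖x‖).card : ℝ≥0∞)⁻¹ else 0) hFn (hs m),
    fun m => lintegral_withDensity_eq_lintegral_mul ξ (hw m) (hFs m)]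
  rw [← lintegral_finsetSum _ fun m _ => (hw m).mul (hFs m)]
  refine lintegral_congr_ae ?_
  filter_upwards [hξ.simplex] with x hx
  have hmem : ‖x‖ ∈ Icc (1 / (k : ℝ)) 1 := by
    refine ⟨one_div_le_norm hx.2, (pi_norm_le_iff_of_nonneg zero_le_one).2 fun i => ?_⟩
    rw [Real.norm_of_nonneg (hx.1 i), ← hx.2]
    exact Finset.single_le_sum (fun j _ => hx.1 j) (Finset.mem_univ i)
  simp only [Pi.mul_apply, norm_starPoint hk hmem]
  rw [← Finset.sum_mul, ← Finset.sum_filter, Finset.sum_const, nsmul_eq_mul,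
    ENNReal.mul_inv_cancel, one_mul]
  · obtain ⟨j, hj⟩ := Finite.exists_max x
    have : j ∈ Finset.univ.filter fun j => x j = ‖x‖ := by
      simp [norm_eq_of_forall_le hx.1 hj]
    exact_mod_cast (Finset.card_pos.2 ⟨j, this⟩).ne'
  · exact ENNReal.natCast_ne_top _

/-! ### The bias of the root -/

/-- If the conditional law of `Y` given that the root has colour `l` is `tilt k l ν`, then `Y` is the
vector of the posterior probabilities of the colours of the root. -/
theorem rootBias_eq {ν : Measure (Fin k → ℝ)} (hν : IsExchangeable ν) {P : Measure (Sample k)}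
    [IsProbabilityMeasure P] {Y : Sample k → Fin k → ℝ} (hY : Measurable Y)
    (hlaw : ∀ l (S : Set (Fin k → ℝ)), MeasurableSet S →
      P ({ω | colour ω [] = l} ∩ Y ⁻¹' S) = ∫⁻ x in S, ENNReal.ofReal (x l) ∂ν) :
    rootBias P Y = ∫ x, ⨆ l : Fin k, |x l - 1 / (k : ℝ)| ∂ν := by
  have := hν.prob
  have hcol : ∀ l : Fin k, MeasurableSet {ω : Sample k | colour ω [] = l} := fun l =>
    measurable_colour [] (measurableSet_singleton l)
  have hmap : P.map Y = ν := by
    ext S hS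
    rw [Measure.map_apply hY hS]
    have hU : Y ⁻¹' S = ⋃ l : Fin k, {ω | colour ω [] = l} ∩ Y ⁻¹' S := by
      ext ω; simp
    rw [hU, measure_iUnion _ fun l => (hcol l).inter (hY hS), tsum_fintype]
    · simp_rw [hlaw _ S hS]
      rw [← lintegral_finsetSum _ fun l _ => by fun_prop]
      trans ∫⁻ _ in S, 1 ∂ν
      · refine lintegral_congr_ae (ae_restrict_of_ae ?_)
        filter_upwards [hν.simplex] with x hx
        rw [← ENNReal.ofReal_sum_of_nonneg fun i _ => hx.1 i, hx.2, ENNReal.ofReal_one]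
      · simp
    · intro l l' hl
      refine Set.disjoint_left.2 fun ω h h' => hl ?_
      exact h.1.symm.trans h'.1
  have hb : ∀ᵐ x ∂ν, ∀ l, 0 ≤ x l ∧ x l ≤ 1 := by
    filter_upwards [hν.simplex, hν.ae_le_one] with x hx hx' l
    exact ⟨hx.1 l, hx' l⟩
  have hYb : ∀ᵐ ω ∂P, ∀ l, 0 ≤ Y ω l ∧ Y ω l ≤ 1 := by
    rw [← hmap] at hb
    exact ae_of_ae_map hY.aemeasurable hb
  have hYl : ∀ l, Measurable fun ω => Y ω l := fun l => (measurable_pi_apply l).comp hY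
  have hYi : ∀ l, Integrable (fun ω => Y ω l) P := by
    intro l
    refine Integrable.of_bound (hYl l).aestronglyMeasurable 1 ?_
    filter_upwards [hYb] with ω hω
    rw [Real.norm_of_nonneg (hω l).1]
    exact (hω l).2
  have hle : MeasurableSpace.comap Y inferInstance ≤
      (inferInstance : MeasurableSpace (Sample k)) := hY.comap_le
  -- The hypothesis `hlaw` is the defining integral identity of the conditional probability on the
  -- sets `Y ⁻¹' S`.
  have hce : ∀ l : Fin k, (fun ω => Y ω l) =ᵐ[P]
      P⟦{ω' : Sample k | colour ω' [] = l} | MeasurableSpace.comap Y inferInstance⟧ := by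
    intro l
    refine ae_eq_condExp_of_forall_setIntegral_eq hle
      ((integrable_const (1 : ℝ)).indicator (hcol l)) (fun s _ _ => (hYi l).integrableOn) ?_ ?_
    · rintro _ ⟨S, hS, rfl⟩ -
      have h1 : ∫ ω in Y ⁻¹' S, Y ω l ∂P = ∫ x in S, x l ∂ν := by
        rw [← hmap, setIntegral_map hS (measurable_pi_apply l).aestronglyMeasurable hY.aemeasurable]
      rw [h1, integral_eq_lintegral_of_nonneg_ae, ← hlaw l S hS,
        setIntegral_indicator (hcol l), setIntegral_const, Measure.real, inter_comm]
      · simp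
      · refine ae_restrict_of_ae ?_
        filter_upwards [hb] with x hx
        exact (hx l).1
      · exact (measurable_pi_apply l).aestronglyMeasurable
    · have : Measurable[MeasurableSpace.comap Y inferInstance] fun ω => Y ω l :=
        (measurable_pi_apply l).comp (comap_measurable Y)
      exact this.stronglyMeasurable.aestronglyMeasurable
  have hsup : Measurable fun x : Fin k → ℝ => ⨆ l : Fin k, |x l - 1 / (k : ℝ)| :=
    Measurable.iSup fun l => by fun_prop
  rw [← hmap, integral_map hY.aemeasurable hsup.aestronglyMeasurable, rootBias]
  refine integral_congr_ae ?_
  filter_upwards [ae_all_iff.2 hce] with ω hω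
  simp_rw [← hω]

/-- A vanishing integral forces the distinguished entry of the star vector to be `1/k` almost
surely, so `μ` would be the excluded point mass. -/
theorem integral_bias_pos (hk : 2 ≤ k) {μ : Measure ℝ} [IsProbabilityMeasure μ]
    (hμ : μ (Icc (1 / (k : ℝ)) 1)ᶜ = 0) (hne : μ ≠ Measure.dirac (1 / (k : ℝ))) :
    0 < ∫ x, ⨆ l : Fin k, |x l - 1 / (k : ℝ)| ∂(toStar k μ) := by
  have : NeZero k := ⟨by omega⟩
  have hν := isExchangeable_toStar hk μ hμ
  have := hν.prob
  have h0 : ∀ x : Fin k → ℝ, 0 ≤ ⨆ l : Fin k, |x l - 1 / (k : ℝ)| := fun x =>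
    Real.iSup_nonneg fun l => abs_nonneg _
  have hsup : Measurable fun x : Fin k → ℝ => ⨆ l : Fin k, |x l - 1 / (k : ℝ)| :=
    Measurable.iSup fun l => by fun_prop
  have hint : Integrable (fun x : Fin k → ℝ => ⨆ l : Fin k, |x l - 1 / (k : ℝ)|) (toStar k μ) := by
    refine Integrable.of_bound hsup.aestronglyMeasurable 1 ?_
    filter_upwards [hν.simplex, hν.ae_le_one] with x hx hx'
    rw [Real.norm_of_nonneg (h0 x)]
    refine ciSup_le fun l => abs_le.2 ⟨?_, ?_⟩
    · have h1 : 1 / (k : ℝ) ≤ 1 := by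
        rw [div_le_one (by positivity)]
        exact_mod_cast NeZero.one_le
      linarith [hx.1 l]
    · have h1 : 0 ≤ 1 / (k : ℝ) := by positivity
      linarith [hx' l]
  refine (integral_nonneg h0).lt_of_ne fun h => hne ?_
  have hz := (integral_eq_zero_iff_of_nonneg h0 hint).1 h.symm
  have hlint : ∫⁻ x, ENNReal.ofReal (⨆ l : Fin k, |x l - 1 / (k : ℝ)|) ∂(toStar k μ) = 0 := by
    rw [lintegral_eq_zero_iff hsup.ennreal_ofReal]
    filter_upwards [hz] with x hx
    rw [hx]
    exact ENNReal.ofReal_zero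
  rw [lintegral_toStar hk μ hsup.ennreal_ofReal, mul_eq_zero, Finset.sum_eq_zero_iff] at hlint
  have h2 := (hlint.resolve_left (by simp)) 0 (Finset.mem_univ _)
  have hm : Measurable fun y => ENNReal.ofReal (⨆ l, |starPoint k y 0 l - 1 / (k : ℝ)|) :=
    hsup.ennreal_ofReal.comp (measurable_starPoint 0)
  rw [lintegral_eq_zero_iff hm] at h2
  have h3 : (fun y => y) =ᵐ[μ] fun _ => 1 / (k : ℝ) := by
    filter_upwards [h2] with y hy
    have h4 : ⨆ l : Fin k, |starPoint k y 0 l - 1 / (k : ℝ)| ≤ 0 := ENNReal.ofReal_eq_zero.1 hy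
    have h5 := (le_ciSup (Set.finite_range fun l : Fin k => |starPoint k y 0 l - 1 / (k : ℝ)|).bddAbove
      (0 : Fin k)).trans h4
    have h6 := abs_nonpos_iff.1 h5
    simp only [starPoint, if_true] at h6
    linarith
  calc μ = μ.map fun y => y := Measure.map_id'.symm
    _ = μ.map fun _ => 1 / (k : ℝ) := Measure.map_congr h3
    _ = Measure.dirac (1 / (k : ℝ)) := by simp [Measure.map_const]

theorem isProbabilityMeasure_law (hk : 2 ≤ k) (ξ : Measure ℕ) [IsProbabilityMeasure ξ] :
    IsProbabilityMeasure (law k ξ) := by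
  have := isProbabilityMeasure_channel hk
  have : NeZero k := ⟨by omega⟩
  have : IsProbabilityMeasure (uniformOn (univ : Set (Fin k))) :=
    isProbabilityMeasure_uniformOn Set.finite_univ univ_nonempty
  unfold law; infer_instance

/-- If `(Λ ∘ Γ_s) μ` dominates `μ`, then there are estimators from which the posterior distribution
of the colour of the root has law `toStar k μ` at every height. -/
theorem exists_estimator (hk : 2 ≤ k) (ξ : Measure ℕ) [IsProbabilityMeasure ξ] {μ : Measure ℝ}
    [IsProbabilityMeasure μ] (hμ : μ (Icc (1 / (k : ℝ)) 1)ᶜ = 0)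
    (hdom : ∀ x, (lambdaGammaS k ξ μ).real (Iic x) ≤ μ.real (Iic x)) :
    ∃ B : ℕ → Observation k → Fin k → ℝ, (∀ n, Measurable (B n)) ∧
      ∀ n, rootBias (law k ξ) (fun ω => B n (observation n ω)) =
        ∫ x, ⨆ l : Fin k, |x l - 1 / (k : ℝ)| ∂(toStar k μ) := by
  have := isProbabilityMeasure_channel hk
  have := isProbabilityMeasure_law hk ξ
  have hν := isExchangeable_toStar hk μ hμ
  have hξ := hν.gammaS hk ξ
  rw [lambdaGammaS, hξ.map_norm_lambda hk] at hdom
  obtain ⟨G, hGm, hG⟩ := hξ.exists_degradation hk hμ hdom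
  -- One uniform variable per vertex is enough randomness to apply the degradation there.
  obtain ⟨f, hfm, hf⟩ := G.exists_measurable_map_eq_unitInterval
  have hg : ∀ j, ∃ g : unitInterval → Fin k → ℝ, Measurable g ∧
      volume.map g = tilt k j (toStar k μ) := fun j => by
    have := hν.isProbabilityMeasure_tilt j
    exact (tilt k j (toStar k μ)).exists_measurable_map_eq
  choose g hgm hg using hg
  refine ⟨estimator g f, measurable_estimator hgm hfm, fun n => ?_⟩
  have hest : Measurable fun ω : Sample k => estimator g f n (observation n ω) :=
    (measurable_estimator hgm hfm n).comp (measurable_observation n)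
  refine rootBias_eq hν hest fun l S hS => ?_
  have hcol : MeasurableSet {ω : Sample k | colour ω [] = l} :=
    measurable_colour [] (measurableSet_singleton l)
  have hk0 : (k : ℝ≥0∞) ≠ 0 := by simp; omega
  rw [← lintegral_indicator_one (hcol.inter (hest hS)),
    lintegral_law hk ξ (measurable_one.indicator (hcol.inter (hest hS))),
    Finset.sum_eq_single_of_mem l (Finset.mem_univ l)]
  · have h1 : ∀ e : Vertex → Mark k,
        ({ω : Sample k | colour ω [] = l} ∩ (fun ω => estimator g f n (observation n ω)) ⁻¹'
          S).indicator (1 : Sample k → ℝ≥0∞) (toSample l e) =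
        S.indicator 1 (estimator g f n (observation n (toSample l e))) := by
      intro e
      have hc : colour (toSample l e) [] = l := rfl
      by_cases h : estimator g f n (observation n (toSample l e)) ∈ S <;>
        simp [Set.indicator, hc, h]
    simp_rw [h1]
    rw [lintegral_estimator hk ξ hν hgm hg hfm hf hG n (fun _ => l) (measurable_one.indicator hS)]
    simp only [lintegral_const, measure_univ, mul_one]
    rw [lintegral_indicator_one hS, tilt, withDensity_apply _ hS,
      ← lintegral_const_mul _ (by fun_prop)]
    refine lintegral_congr fun x => ?_
    rw [ENNReal.ofReal_mul (by positivity), ENNReal.ofReal_natCast, ← mul_assoc,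
      ENNReal.inv_mul_cancel hk0 (ENNReal.natCast_ne_top k), one_mul]
  · intro r _ hr
    refine (lintegral_congr fun e => ?_).trans lintegral_zero
    exact Set.indicator_of_notMem (fun h => hr h.1) _

end ColouringReconstruction

end

open ColouringReconstruction
theorem mainTheorem4 (k : ℕ) (hk : 2 ≤ k) (d : ℝ≥0) (h : HasDominatedMeasure k d) :
    ∃ (𝓑 : Type) (_ : MeasurableSpace 𝓑)
      (B : ℕ → Set Vertex × Set (Vertex × Fin k) × (Vertex → unitInterval) → 𝓑),
      (∀ n, Measurable (B n)) ∧
      0 < liminf (fun n => rootBias (law k (poissonMeasure d)) fun ω => B n (observation n ω))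
        atTop := by
  obtain ⟨μ, hprob, hμ, hne, c, hc, hdom⟩ := h
  have hlog : 0 < Real.log k := Real.log_pos (by exact_mod_cast hk)
  obtain ⟨B, hB, hbias⟩ := exists_estimator hk (poissonMeasure d) hμ fun x => by
    -- Each alternative gives plain domination; the first needs that the law after the recursion has
    -- total mass one.
    rcases hdom x with h | h | h
    · rw [h]
      have hν := isExchangeable_toStar hk μ hμ
      have hξ := hν.gammaS hk (poissonMeasure d)
      have := hξ.prob
      rw [lambdaGammaS, hξ.map_norm_lambda hk]
      have : IsProbabilityMeasure ((gammaS k (poissonMeasure d) (toStar k μ)).map fun x => ‖x‖) :=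
        Measure.isProbabilityMeasure_map measurable_norm.aemeasurable
      exact measureReal_le_one
    · rw [h]
      exact measureReal_nonneg
    · have : 0 < c / Real.log k := div_pos hc hlog
      linarith
  refine ⟨Fin k → ℝ, inferInstance, B, hB, ?_⟩
  simp_rw [hbias]
  rw [liminf_const]
  exact integral_bias_pos hk hμ hne
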